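/- **Notation.** For $\alpha>-\tfrac12$ let $C_n^{(\alpha)}$ be the Gegenbauer polynomials standardized by $C_n^{(\alpha)}(1)=1$, that is $C_0^{(\alpha)}=1$, $C_1^{(\alpha)}(x)=x$ and $(n+2\alpha)C_{n+1}^{(\alpha)}(x)=2(n+\alpha)x\,C_n^{(\alpha)}(x)-n\,C_{n-1}^{(\alpha)}(x)$ for $n\ge1$. Let $K_n^{(\alpha)}$ be the leading coefficient of $C_n^{(\alpha)}$ and $\lambda_n^{(\alpha)}=\int_{-1}^1 \bigl(C_n^{(\alpha)}(x)\bigr)^2(1-x^2)^{\alpha-1/2}\,dx$. For $L>0$ put $C_{L,n}^{(\alpha)}(x)=C_n^{(\alpha)}(2x/L-1)$ and $\lambda_{L,n}^{(\alpha)}=(L/2)^{2\alpha}\lambda_n^{(\alpha)}$. For $m\ge 0$ let $z_0,\dots,z_m$ be the zeros of $C_{L,m+1}^{(\alpha)}$, with Christoffel numbers $\varpi_{L,m,k}^{(\alpha)}=(L/2)^{2\alpha}\Bigl(\sum_{j=0}^m (\lambda_j^{(\alpha)})^{-1}\bigl(C_{L,j}^{(\alpha)}(z_k)\bigr)^2\Bigr)^{-1}$.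 The S-quadrature with parameter $\alpha$ for an integration node $y\in[0,L]$ is $$\int_0^{y} f(x)\,dx\approx\sum_{k=0}^m p_k\,f(z_k),\qquad p_k=\varpi_{L,m,k}^{(\alpha)}\sum_{j=0}^m\bigl(\lambda_{L,j}^{(\alpha)}\bigr)^{-1}C_{L,j}^{(\alpha)}(z_k)\int_0^{y}C_{L,j}^{(\alpha)}(x)\,dx,$$ and its truncation error $E_{L,m}^{(\alpha)}(y)$ is the integral minus the sum. A number $\alpha^*>-\tfrac12$ is an optimal parameter for $y$ if it minimizes $\eta^2$ over $(-\tfrac12,\infty)$, where $\eta(\alpha)=\frac{2^m}{K_{m+1}^{(\alpha)}}\int_0^{y}C_{L,m+1}^{(\alpha)}(x)\,dx$; the S-quadrature with $\alpha=\alpha^*$ is then called optimal. For real $r$ and an integer $k\ge0$, $\binom rk=r(r-1)\cdots(r-k+1)/k!$. **Theorem (Error bounds).** There are positive constants $D_1^{(\alpha)},D_2^{(\alpha)}$, depending only on $\alpha>-\tfrac12$ (in particular, as functions of $\alpha$, independent of $m$), such that the following holds. Let $L>0$, $A>0$, let $m\ge0$ be an integer, and let $f\in C^{m+1}[0,L]$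 with $\|f^{(m+1)}\|_{L^\infty[0,L]}\le A$. Let $x_0,\dots,x_n\in[0,L]$, let $\alpha_i^*$ be an optimal parameter for $x_i$, and let $E_i=E_{L,m}^{(\alpha_i^*)}(x_i)$ be the truncation error of the optimal S-quadrature. Then for every $i=0,\dots,n$, writing $\alpha=\alpha_i^*$: 1. If $\alpha\ge0$, then $$|E_i|\le\frac{A\,2^{-2m-1}\,\Gamma(\alpha+1)\,x_i\,L^{m+1}\,\Gamma(m+2\alpha+1)}{\Gamma(2\alpha+1)\,\Gamma(m+2)\,\Gamma(m+\alpha+1)}.$$ 2. If $-\tfrac12<\alpha<0$ and $m$ is odd, then $$|E_i|\le\frac{A\,2^{-2m-1}\,\Gamma(\alpha+1)\,x_i\,L^{m+1}\,\Gamma(m+2\alpha+1)}{\Gamma(2\alpha+1)\,\Gamma(m+2)\,\Gamma(m+\alpha+1)}\cdot\frac{(m+1)!\,|\Gamma(2\alpha)|}{\Gamma(m+2\alpha+1)}\left|\binom{\frac{m+1}2+\alpha-1}{\frac{m+1}2}\right|.$$ 3. If $-\tfrac12<\alpha<0$ and $m$ is even, then $$|E_i|\le\frac{A\,2^{-2m-1}\,|\Gamma(\alpha)|\,|\alpha|\,x_i\,L^{m+1}}{\sqrt{(m+1)(2\alpha+m+1)}\;\Gamma(m+\alpha+1)}\left|\binom{\frac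 m2+\alpha}{\frac m2}\right|,$$ with strict inequality if $x_i>0$. 4. With $B_1^{(\alpha)}=A\,D_1^{(\alpha)}$ and $B_2^{(\alpha)}=B_1^{(\alpha)}D_2^{(\alpha)}$, for every $m\ge1$, $$|E_i|\le B_1^{(\alpha)}\frac{e^m L^{m+1}x_i}{2^{2m+1}\,m^{m+3/2-\alpha}}\quad\text{if }\alpha\ge0,\qquad |E_i|\le B_2^{(\alpha)}\frac{e^m L^{m+1}x_i}{2^{2m+1}\,m^{m+3/2}}\quad\text{if }-\tfrac12<\alpha<0.$$ -/

import Mathlib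

open scoped Polynomial

namespace SGegenbauer

noncomputable section

/-- The Gegenbauer polynomial `C_n^{(α)}`, standardized so that its value at `1` is `1`:
`(n + 2α) C_{n+1} = 2 (n + α) x C_n - n C_{n-1}` for `n ≥ 1`, with `C_0 = 1` and `C_1 = x`. -/
def gegenbauer (α : ℝ) : ℕ → ℝ[X]
  | 0 => 1
  | 1 => Polynomial.X
  | (n + 2) =>
      Polynomial.C (1 / ((n : ℝ) + 1 + 2 * α)) *
        (Polynomial.C (2 * ((n : ℝ) + 1 + α)) * Polynomial.X * gegenbauer α (n + 1)
          - Polynomial.C ((n : ℝ) + 1) * gegenbauer α n)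

/-- The leading coefficient `K_n^{(α)}` of `C_n^{(α)}`. -/
def leadCoeff (α : ℝ) (n : ℕ) : ℝ := (gegenbauer α n).leadingCoeff

/-- The normalization factor `λ_n^{(α)}`, the squared norm of `C_n^{(α)}` for the weight
`(1 - x²)^{α - 1/2}` on `[-1, 1]`. -/
def normFactor (α : ℝ) (n : ℕ) : ℝ :=
  ∫ x in (-1 : ℝ)..1, ((gegenbauer α n).eval x) ^ 2 * (1 - x ^ 2) ^ (α - 1 / 2)

/-- The Christoffel number of order `m` attached to the node `t`:
`ϖ⁻¹ = ∑_{j ≤ m} λ_j⁻¹ C_j(t)²`. -/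
def christoffel (α : ℝ) (m : ℕ) (t : ℝ) : ℝ :=
  (∑ j ∈ Finset.range (m + 1), (normFactor α j)⁻¹ * ((gegenbauer α j).eval t) ^ 2)⁻¹

/-- The shifted Gegenbauer polynomial `C_{L,n}^{(α)}(x) = C_n^{(α)}(2x/L - 1)`. -/
def shifted (L α : ℝ) (n : ℕ) : ℝ[X] :=
  (gegenbauer α n).comp (Polynomial.C (2 / L) * Polynomial.X - 1)

/-- `λ_{L,n}^{(α)} = (L/2)^{2α} λ_n^{(α)}`. -/
def shiftedNormFactor (L α : ℝ) (n : ℕ) : ℝ := (L / 2) ^ (2 * α) * normFactor α n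

/-- The Christoffel number `(L/2)^{2α} ϖ` of order `m` at the shifted node `z = (L/2)(t + 1)`. -/
def shiftedChristoffel (L α : ℝ) (m : ℕ) (z : ℝ) : ℝ :=
  (L / 2) ^ (2 * α) * christoffel α m (2 * z / L - 1)

/-- The shifted Gegenbauer-Gauss nodes: the set of the zeros of `C_{L,m+1}^{(α)}`. -/
def nodes (L α : ℝ) (m : ℕ) : Finset ℝ := (shifted L α (m + 1)).roots.toFinset

/-- The entry of the shifted Gegenbauer integration matrix for the integration node `y` and the
interpolation node `z`. -/
def matrixEntry (L α : ℝ) (m : ℕ) (y z : ℝ) : ℝ :=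
  shiftedChristoffel L α m z *
    ∑ j ∈ Finset.range (m + 1),
      (shiftedNormFactor L α j)⁻¹ * (shifted L α j).eval z *
        ∫ t in (0 : ℝ)..y, (shifted L α j).eval t

/-- The S-quadrature with parameter `α` and `m + 1` nodes for the integral of `f` over `[0, y]`. -/
def quadrature (L α : ℝ) (m : ℕ) (f : ℝ → ℝ) (y : ℝ) : ℝ :=
  ∑ z ∈ nodes L α m, matrixEntry L α m y z * f z

/-- The truncation error of the S-quadrature. -/
def quadError (L α : ℝ) (m : ℕ) (f : ℝ → ℝ) (y : ℝ) : ℝ :=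
  (∫ t in (0 : ℝ)..y, f t) - quadrature L α m f y

/-- The function `η(α) = (2^m / K_{m+1}^{(α)}) ∫₀^y C_{L,m+1}^{(α)}`. -/
def eta (L y : ℝ) (m : ℕ) (α : ℝ) : ℝ :=
  2 ^ m / leadCoeff α (m + 1) * ∫ t in (0 : ℝ)..y, (shifted L α (m + 1)).eval t

/-- `α` is an optimal Gegenbauer parameter for the integration node `y`: a minimizer of `η²`
over the interval `(-1/2, ∞)`. -/
def IsOptimal (L y : ℝ) (m : ℕ) (α : ℝ) : Prop :=
  -1 / 2 < α ∧ ∀ β : ℝ, -1 / 2 < β → (eta L y m α) ^ 2 ≤ (eta L y m β) ^ 2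

end

end SGegenbauer

/-! ### Algebra of the Gegenbauer polynomials: leading coefficient, differential equation, parity,
location of zeros -/

namespace SGegenbauer

/-! The weights are integrals of the Christoffel-Darboux kernel divided by its diagonal value. By
`christoffel_darboux` this normalized kernel is the Lagrange basis at the zeros of `C_{L,m+1}`, so
the quadrature integrates exactly the polynomial of degree at most `m` that interpolates `f` there.
The interpolation remainder is at most `A/(m+1)!` times `|C_{L,m+1}|` over its leading coefficient
`K_{m+1}(2/L)^(m+1)`. Integrating over `[0, y]` gives `abs_quadError_le`, which only needs a bound
`M` for `|C_{m+1}|` on `[-1, 1]`.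

For `M`, the differential equation shows that `energy`, which dominates `C_n²` on `[-1, 1]`, has a
derivative with the sign of `αx`. If `α ≥ 0`, its maximum over `[-1, 1]` is its value `1` at the
endpoints. If `α < 0`, the maximum is at the origin: it equals `C_n(0)²` in even degree and
`C_n'(0)²/(n(n+2α))` in odd degree. The values at the origin are explicit in Gamma functions and
binomials. In odd degree the bound is strict, since `C_n` itself vanishes at `0` and the energy is
not constant on any interval.

That there are `m+1` nodes also comes from Christoffel-Darboux: used over `ℂ` at a zero and its
conjugate it makes the zeros real, and used over `ℝ[X]` and differentiated it makes them simple. The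
asymptotic bounds follow from Euler's limit for Gamma and Stirling's inequality. -/

open Polynomial in
theorem gegenbauer_recurrence {α : ℝ} (hα : -1 / 2 < α) (n : ℕ) :
    C ((n : ℝ) + 1 + 2 * α) * gegenbauer α (n + 2) =
      C (2 * ((n : ℝ) + 1 + α)) * X * gegenbauer α (n + 1) - C ((n : ℝ) + 1) * gegenbauer α n := by
  have h : (n : ℝ) + 1 + 2 * α ≠ 0 := by
    have : (0 : ℝ) ≤ n := n.cast_nonneg
    linarith
  rw [gegenbauer, ← mul_assoc, ← C_mul, mul_one_div_cancel h, C_1, one_mul]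

theorem eval_gegenbauer_recurrence {α : ℝ} (hα : -1 / 2 < α) (n : ℕ) (x : ℝ) :
    ((n : ℝ) + 1 + 2 * α) * (gegenbauer α (n + 2)).eval x =
      2 * ((n : ℝ) + 1 + α) * x * (gegenbauer α (n + 1)).eval x
        - ((n : ℝ) + 1) * (gegenbauer α n).eval x := by
  simpa using congrArg (Polynomial.eval x) (gegenbauer_recurrence hα n)

-- The top coefficient of `C_{n+2}` comes from `x C_{n+1}` alone, with the factor
-- `2(n+1+α)/(n+1+2α)`, positive because `α > -1/2`.
open Polynomial in
theorem gegenbauer_natDegree_and_leadCoeff {α : ℝ} (hα : -1 / 2 < α) (n : ℕ) :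
    (gegenbauer α n).natDegree = n ∧ 0 < leadCoeff α n := by
  have key : ∀ n : ℕ, ((gegenbauer α n).natDegree ≤ n ∧ 0 < (gegenbauer α n).coeff n) ∧
      ((gegenbauer α (n + 1)).natDegree ≤ n + 1 ∧
        0 < (gegenbauer α (n + 1)).coeff (n + 1)) := by
    intro n
    induction n with
    | zero => simp [gegenbauer]
    | succ n ih =>
      obtain ⟨⟨h1, h2⟩, h3, h4⟩ := ih
      have hn : (0 : ℝ) ≤ n := n.cast_nonneg
      refine ⟨⟨h3, h4⟩, ?_, ?_⟩
      · rw [gegenbauer]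
        compute_degree
        omega
      · have h5 : (gegenbauer α n).coeff (n + 2) = 0 :=
          coeff_eq_zero_of_natDegree_lt (by omega)
        rw [gegenbauer, coeff_C_mul, coeff_sub, coeff_C_mul, h5, mul_assoc, coeff_C_mul,
          coeff_X_mul, mul_zero, sub_zero]
        have : 0 < (n : ℝ) + 1 + 2 * α := by linarith
        have : 0 < (n : ℝ) + 1 + α := by linarith
        positivity
  obtain ⟨h1, h2⟩ := (key n).1
  have h3 : (gegenbauer α n).natDegree = n :=
    le_antisymm h1 (le_natDegree_of_ne_zero h2.ne')
  exact ⟨h3, by rw [leadCoeff, leadingCoeff, h3]; exact h2⟩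

theorem natDegree_gegenbauer {α : ℝ} (hα : -1 / 2 < α) (n : ℕ) :
    (gegenbauer α n).natDegree = n :=
  (gegenbauer_natDegree_and_leadCoeff hα n).1

theorem leadCoeff_pos {α : ℝ} (hα : -1 / 2 < α) (n : ℕ) : 0 < leadCoeff α n :=
  (gegenbauer_natDegree_and_leadCoeff hα n).2

theorem gegenbauer_ne_zero {α : ℝ} (hα : -1 / 2 < α) (n : ℕ) : gegenbauer α n ≠ 0 := by
  intro h
  have := leadCoeff_pos hα n
  simp [leadCoeff, h] at this

open Polynomial in
theorem leadCoeff_succ {α : ℝ} (hα : -1 / 2 < α) (n : ℕ) :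
    ((n : ℝ) + 1 + 2 * α) * leadCoeff α (n + 2) =
      2 * ((n : ℝ) + 1 + α) * leadCoeff α (n + 1) := by
  have h := congrArg (fun p => p.coeff (n + 2)) (gegenbauer_recurrence hα n)
  have h5 : (gegenbauer α n).coeff (n + 2) = 0 :=
    coeff_eq_zero_of_natDegree_lt (by rw [natDegree_gegenbauer hα]; omega)
  simp only [coeff_sub, coeff_C_mul, mul_assoc (C _) X, coeff_X_mul, h5, mul_zero, sub_zero] at h
  simpa only [leadCoeff, leadingCoeff, natDegree_gegenbauer hα] using h

/-- Starting from degree `1` keeps every Gamma argument positive on the whole range `α > -1/2`,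
including `α = 0`. -/
theorem leadCoeff_eq_Gamma {α : ℝ} (hα : -1 / 2 < α) (m : ℕ) :
    leadCoeff α (m + 1) = 2 ^ m * Real.Gamma (m + α + 1) * Real.Gamma (2 * α + 1) /
      (Real.Gamma (α + 1) * Real.Gamma (m + 2 * α + 1)) := by
  have h1 : 0 < Real.Gamma (α + 1) := Real.Gamma_pos_of_pos (by linarith)
  have h2 : 0 < Real.Gamma (2 * α + 1) := Real.Gamma_pos_of_pos (by linarith)
  induction m with
  | zero =>
    rw [eq_div_iff (by simpa using ⟨h1.ne', h2.ne'⟩)]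
    simp [leadCoeff, gegenbauer]
  | succ m ih =>
    have hm : (0 : ℝ) ≤ m := m.cast_nonneg
    have h3 : 0 < Real.Gamma (m + 2 * α + 1) := Real.Gamma_pos_of_pos (by linarith)
    have h4 : 0 < (m : ℝ) + 1 + 2 * α := by linarith
    have h5 := leadCoeff_succ hα m
    have e1 : Real.Gamma (((m + 1 : ℕ) : ℝ) + α + 1) = (m + α + 1) * Real.Gamma (m + α + 1) := by
      rw [← Real.Gamma_add_one (by linarith)]; congr 1; push_cast; ring
    have e2 : Real.Gamma (((m + 1 : ℕ) : ℝ) + 2 * α + 1) =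
        (m + 1 + 2 * α) * Real.Gamma (m + 2 * α + 1) := by
      rw [show (m : ℝ) + 1 + 2 * α = m + 2 * α + 1 by ring, ← Real.Gamma_add_one (by linarith)]
      congr 1; push_cast; ring
    rw [ih] at h5
    rw [e1, e2, eq_div_iff (by positivity)]
    calc _ = ((m : ℝ) + 1 + 2 * α) * leadCoeff α (m + 2) *
          (Real.Gamma (α + 1) * Real.Gamma (m + 2 * α + 1)) := by ring
      _ = _ := by rw [h5]; field_simp; ring

open Polynomial in
/-- The two structure relations expressing `(1 - x²) C_n'` through neighbouring polynomials. -/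
theorem gegenbauer_structure {α : ℝ} (hα : -1 / 2 < α) (n : ℕ) :
    (1 - X ^ 2) * derivative (gegenbauer α n) =
        C ((n : ℝ) + 2 * α) * (X * gegenbauer α n - gegenbauer α (n + 1)) ∧
      (1 - X ^ 2) * derivative (gegenbauer α (n + 1)) =
        C ((n : ℝ) + 1) * (gegenbauer α n - X * gegenbauer α (n + 1)) := by
  induction n with
  | zero =>
    simp [gegenbauer]
    ring
  | succ n ih =>
    obtain ⟨h1, h2⟩ := ih
    have hr := gegenbauer_recurrence hα n
    have hd := congrArg derivative hr
    have hne : C ((n : ℝ) + 1 + 2 * α) ≠ 0 := by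
      have : (0 : ℝ) ≤ n := n.cast_nonneg
      exact C_ne_zero.2 (by linarith)
    simp only [derivative_sub, derivative_mul, derivative_C, derivative_X, zero_mul, zero_add,
      mul_one] at hd
    simp only [C_add, C_mul, C_1, map_natCast, C_ofNat, Nat.cast_add, Nat.cast_one]
      at h1 h2 hr hd hne ⊢
    -- The first relation at `n + 1` is the second at `n` corrected by the recurrence. The second
    -- comes from the differentiated recurrence times `1 - X²`.
    constructor
    · linear_combination h2 + hr
    · apply mul_left_cancel₀ hne
      linear_combination (1 - X ^ 2) * hd + 2 * ((n : ℝ[X]) + 1 + C α) * X * h2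
        - ((n : ℝ[X]) + 1) * h1 + ((n : ℝ[X]) + 2) * X * hr

-- Differentiate the second structure relation, multiply by `1 - X²`, and eliminate the neighbouring
-- polynomial and its derivative with both relations.
open Polynomial in
theorem gegenbauer_ode {α : ℝ} (hα : -1 / 2 < α) (n : ℕ) :
    (1 - X ^ 2) * derivative (derivative (gegenbauer α n)) =
      C (2 * α + 1) * X * derivative (gegenbauer α n)
        - C ((n : ℝ) * (n + 2 * α)) * gegenbauer α n := by
  cases n with
  | zero => simp [gegenbauer]
  | succ n =>
    obtain ⟨h1, h2⟩ := gegenbauer_structure hα n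
    have hd := congrArg derivative h2
    have hne : (1 - X ^ 2 : ℝ[X]) ≠ 0 := by
      intro h
      simpa using congrArg (eval 0) h
    simp only [derivative_sub, derivative_mul, derivative_C, derivative_X, derivative_one,
      derivative_X_pow, zero_mul, zero_add] at hd
    simp only [C_add, C_mul, C_1, map_natCast, C_ofNat, Nat.cast_add, Nat.cast_one,
      Nat.cast_ofNat] at h1 h2 hd ⊢
    apply mul_left_cancel₀ hne
    linear_combination (1 - X ^ 2) * hd + ((n : ℝ[X]) + 1) * h1
      - ((n : ℝ[X]) + 2 * C α) * X * h2

open Polynomial in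
theorem eval_gegenbauer_ode {α : ℝ} (hα : -1 / 2 < α) (n : ℕ) (x : ℝ) :
    (1 - x ^ 2) * (derivative (derivative (gegenbauer α n))).eval x =
      (2 * α + 1) * x * (derivative (gegenbauer α n)).eval x
        - (n : ℝ) * (n + 2 * α) * (gegenbauer α n).eval x := by
  simpa using congrArg (eval x) (gegenbauer_ode hα n)

theorem eval_gegenbauer_neg (α : ℝ) (n : ℕ) (x : ℝ) :
    (gegenbauer α n).eval (-x) = (-1) ^ n * (gegenbauer α n).eval x := by
  induction n using gegenbauer.induct with
  | case1 => simp [gegenbauer]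
  | case2 => simp [gegenbauer]
  | case3 n h1 h2 =>
    simp only [gegenbauer, Polynomial.eval_mul, Polynomial.eval_sub, Polynomial.eval_C,
      Polynomial.eval_X, h1, h2, pow_succ]
    ring

theorem one_le_eval_gegenbauer {α : ℝ} (hα : -1 / 2 < α) (n : ℕ) {x : ℝ} (hx : 1 ≤ x) :
    1 ≤ (gegenbauer α n).eval x := by
  have key : 1 ≤ (gegenbauer α n).eval x ∧
      (gegenbauer α n).eval x ≤ (gegenbauer α (n + 1)).eval x := by
    induction n with
    | zero => simpa [gegenbauer]
    | succ n ih =>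
      have hn : (0 : ℝ) ≤ n := n.cast_nonneg
      refine ⟨ih.1.trans ih.2, ?_⟩
      have h := eval_gegenbauer_recurrence hα n x
      have h1 : 0 < (n : ℝ) + 1 + 2 * α := by linarith
      -- The recurrence reads `(n+1+2α)(C_{n+2} - C_{n+1}) = 2(n+1+α)(x-1)C_{n+1} + (n+1)(C_{n+1} -
      -- C_n)`, so for `x ≥ 1` the values increase with the degree.
      have h2 : 0 ≤ ((n : ℝ) + 1 + α) * (x - 1) * (gegenbauer α (n + 1)).eval x :=
        mul_nonneg (mul_nonneg (by linarith) (by linarith)) (by linarith)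
      have h3 : 0 ≤ ((n : ℝ) + 1) *
          ((gegenbauer α (n + 1)).eval x - (gegenbauer α n).eval x) :=
        mul_nonneg (by linarith) (by linarith)
      refine le_of_mul_le_mul_left ?_ h1
      linarith
  exact key.1

theorem eval_one_gegenbauer {α : ℝ} (hα : -1 / 2 < α) (n : ℕ) :
    (gegenbauer α n).eval 1 = 1 := by
  induction n with
  | zero => simp [gegenbauer]
  | succ n ih =>
    have h := congrArg (Polynomial.eval 1) (gegenbauer_structure hα n).2
    have hn : (n : ℝ) + 1 ≠ 0 := by positivity
    simp [hn, ih] at h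
    linarith

theorem abs_lt_one_of_isRoot_gegenbauer {α : ℝ} (hα : -1 / 2 < α) {n : ℕ} {x : ℝ}
    (hx : (gegenbauer α n).eval x = 0) : |x| < 1 := by
  by_contra! h
  rcases le_abs'.1 h with h | h
  · have := one_le_eval_gegenbauer hα n (x := -x) (by linarith)
    rw [eval_gegenbauer_neg, hx, mul_zero] at this
    linarith
  · have := one_le_eval_gegenbauer hα n h
    linarith

end SGegenbauer

/-! ### Maximum of the polynomials on `[-1, 1]` through the energy function -/

namespace SGegenbauer

/-- The function `y² + (1 - x²) y'² / (n (n + 2α))` of a Gegenbauer polynomial `y`, whose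
monotonicity controls the relative maxima of `y²`. -/
noncomputable def energy (α : ℝ) (n : ℕ) (x : ℝ) : ℝ :=
  (gegenbauer α n).eval x ^ 2 +
    (1 - x ^ 2) * (Polynomial.derivative (gegenbauer α n)).eval x ^ 2 / (n * (n + 2 * α))

theorem mul_add_two_mul_pos {α : ℝ} (hα : -1 / 2 < α) {n : ℕ} (hn : 1 ≤ n) :
    0 < (n : ℝ) * (n + 2 * α) := by
  have : (1 : ℝ) ≤ n := by exact_mod_cast hn
  exact mul_pos (by linarith) (by linarith)

/-- Replacing `(1 - x²)y''` by the differential equation cancels the terms in `y y'`. What remains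
is a multiple of `y'²` with the sign of `αx`. -/
theorem hasDerivAt_energy {α : ℝ} (hα : -1 / 2 < α) {n : ℕ} (hn : 1 ≤ n) (x : ℝ) :
    HasDerivAt (energy α n)
      (4 * α * x * (Polynomial.derivative (gegenbauer α n)).eval x ^ 2 / (n * (n + 2 * α))) x := by
  have hN := mul_add_two_mul_pos hα hn
  have h1 := (gegenbauer α n).hasDerivAt x
  have h2 := (Polynomial.derivative (gegenbauer α n)).hasDerivAt x
  have h3 := (h1.pow 2).add
    ((((hasDerivAt_id x).pow 2).const_sub 1 |>.mul (h2.pow 2)).div_const ((n : ℝ) * (n + 2 * α)))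
  refine h3.congr_deriv ?_
  have ho := eval_gegenbauer_ode hα n x
  simp only [id, Nat.cast_ofNat, Nat.add_one_sub_one, pow_one, Pi.pow_apply, mul_one]
  generalize (n : ℝ) * (n + 2 * α) = N at *
  field_simp
  linear_combination 2 * (Polynomial.derivative (gegenbauer α n)).eval x * ho

theorem sq_eval_le_energy {α : ℝ} (hα : -1 / 2 < α) {n : ℕ} (hn : 1 ≤ n) {x : ℝ} (hx : |x| ≤ 1) :
    (gegenbauer α n).eval x ^ 2 ≤ energy α n x := by
  have hN := mul_add_two_mul_pos hα hn
  have : 0 ≤ 1 - x ^ 2 := by nlinarith [abs_le.1 hx]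
  exact le_add_of_nonneg_right (by positivity)

theorem sq_eval_gegenbauer_abs (α : ℝ) (n : ℕ) (x : ℝ) :
    (gegenbauer α n).eval |x| ^ 2 = (gegenbauer α n).eval x ^ 2 := by
  rcases abs_choice x with h | h
  · rw [h]
  · rw [h, eval_gegenbauer_neg, mul_pow, ← pow_mul, mul_comm n, pow_mul]
    norm_num

theorem abs_eval_gegenbauer_le_one {α : ℝ} (hα : 0 ≤ α) (n : ℕ) {x : ℝ} (hx : |x| ≤ 1) :
    |(gegenbauer α n).eval x| ≤ 1 := by
  have hα' : -1 / 2 < α := by linarith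
  rcases Nat.eq_zero_or_pos n with rfl | hn
  · simp [gegenbauer]
  have hN := mul_add_two_mul_pos hα' hn
  have hmono : MonotoneOn (energy α n) (Set.Ici 0) :=
    monotoneOn_of_hasDerivWithinAt_nonneg (convex_Ici 0)
      (fun t _ => (hasDerivAt_energy hα' hn t).continuousAt.continuousWithinAt)
      (fun t _ => (hasDerivAt_energy hα' hn t).hasDerivWithinAt)
      (fun t ht => by
        rw [interior_Ici] at ht
        have : (0 : ℝ) < t := ht
        positivity)
  have h1 : energy α n |x| ≤ energy α n 1 :=
    hmono (abs_nonneg x) (zero_le_one' ℝ) hx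
  have h2 := sq_eval_le_energy hα' hn (x := |x|) (by rwa [abs_abs])
  rw [sq_eval_gegenbauer_abs] at h2
  rw [← sq_le_one_iff_abs_le_one]
  calc _ ≤ energy α n 1 := h2.trans h1
    _ = 1 := by simp [energy, eval_one_gegenbauer hα']

theorem antitoneOn_energy {α : ℝ} (hα : -1 / 2 < α) (hα0 : α < 0) {n : ℕ} (hn : 1 ≤ n) :
    AntitoneOn (energy α n) (Set.Ici 0) := by
  have hN := mul_add_two_mul_pos hα hn
  refine antitoneOn_of_hasDerivWithinAt_nonpos (convex_Ici 0)
    (fun t _ => (hasDerivAt_energy hα hn t).continuousAt.continuousWithinAt)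
    (fun t _ => (hasDerivAt_energy hα hn t).hasDerivWithinAt) (fun t ht => ?_)
  rw [interior_Ici] at ht
  have ht : (0 : ℝ) < t := ht
  refine div_nonpos_of_nonpos_of_nonneg (mul_nonpos_of_nonpos_of_nonneg ?_ (sq_nonneg _)) hN.le
  nlinarith

theorem sq_eval_gegenbauer_le_energy_zero {α : ℝ} (hα : -1 / 2 < α) (hα0 : α < 0) {n : ℕ}
    (hn : 1 ≤ n) {x : ℝ} (hx : |x| ≤ 1) :
    (gegenbauer α n).eval x ^ 2 ≤ energy α n 0 := by
  have h2 := sq_eval_le_energy hα hn (x := |x|) (by rwa [abs_abs])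
  rw [sq_eval_gegenbauer_abs] at h2
  exact h2.trans (antitoneOn_energy hα hα0 hn Set.self_mem_Ici (abs_nonneg x) (abs_nonneg x))

/-- Equality at some `x ≠ 0` would make the monotone energy constant on `(0, |x|)`. Then `C_n'`
would vanish on an interval, against `n ≥ 1`. -/
theorem sq_eval_gegenbauer_lt_energy_zero {α : ℝ} (hα : -1 / 2 < α) (hα0 : α < 0) {n : ℕ}
    (hn : 1 ≤ n) {x : ℝ} (hx0 : x ≠ 0) (hx : |x| ≤ 1) :
    (gegenbauer α n).eval x ^ 2 < energy α n 0 := by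
  refine (sq_eval_gegenbauer_le_energy_zero hα hα0 hn hx).lt_of_ne fun heq => ?_
  have hN := mul_add_two_mul_pos hα hn
  have hanti := antitoneOn_energy hα hα0 hn
  have h2 := sq_eval_le_energy hα hn (x := |x|) (by rwa [abs_abs])
  rw [sq_eval_gegenbauer_abs, heq] at h2
  have hconst : ∀ t ∈ Set.Ioo 0 |x|, energy α n t = energy α n 0 := fun t ht =>
    le_antisymm (hanti Set.self_mem_Ici ht.1.le ht.1.le)
      (h2.trans (hanti ht.1.le (abs_nonneg x) ht.2.le))
  have hroot : ∀ t ∈ Set.Ioo 0 |x|, (Polynomial.derivative (gegenbauer α n)).IsRoot t := by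
    intro t ht
    have h3 : HasDerivAt (energy α n) 0 t :=
      (hasDerivAt_const t (energy α n 0)).congr_of_eventuallyEq
        (Filter.eventually_of_mem (Ioo_mem_nhds ht.1 ht.2) hconst)
    have h4 := (hasDerivAt_energy hα hn t).unique h3
    have h5 : 4 * α * t ≠ 0 := mul_ne_zero (mul_ne_zero four_ne_zero hα0.ne) ht.1.ne'
    exact (pow_eq_zero_iff two_ne_zero).1
      ((mul_eq_zero.1 ((div_eq_zero_iff.1 h4).resolve_right hN.ne')).resolve_left h5)
  have hzero := Polynomial.eq_zero_of_infinite_isRoot _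
    ((Set.Ioo_infinite (abs_pos.2 hx0)).mono hroot)
  have := Polynomial.derivative_eq_zero.1 hzero
  rw [natDegree_gegenbauer hα] at this
  omega

theorem one_le_energy_zero {α : ℝ} (hα : -1 / 2 < α) (hα0 : α < 0) {n : ℕ} (hn : 1 ≤ n) :
    1 ≤ energy α n 0 := by
  have h := sq_eval_gegenbauer_le_energy_zero hα hα0 hn (x := 1) (by simp)
  rwa [eval_one_gegenbauer hα, one_pow] at h

theorem eval_zero_gegenbauer_odd (α : ℝ) (k : ℕ) : (gegenbauer α (2 * k + 1)).eval 0 = 0 := by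
  have h := eval_gegenbauer_neg α (2 * k + 1) 0
  rw [neg_zero, pow_succ, pow_mul] at h
  norm_num at h
  linarith

theorem eval_zero_derivative_gegenbauer_succ {α : ℝ} (hα : -1 / 2 < α) (n : ℕ) :
    (Polynomial.derivative (gegenbauer α (n + 1))).eval 0 =
      (n + 1) * (gegenbauer α n).eval 0 := by
  simpa using congrArg (Polynomial.eval 0) (gegenbauer_structure hα n).2

/-- In even degree `C_n'(0)` is a multiple of `C_{n-1}(0) = 0`, so the energy at `0` is just
`C_n(0)²`. -/
theorem abs_eval_gegenbauer_even_le {α : ℝ} (hα : -1 / 2 < α) (hα0 : α < 0) {k : ℕ} (hk : 1 ≤ k)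
    {x : ℝ} (hx : |x| ≤ 1) :
    |(gegenbauer α (2 * k)).eval x| ≤ |(gegenbauer α (2 * k)).eval 0| := by
  rw [← sq_le_sq]
  have h := sq_eval_gegenbauer_le_energy_zero hα hα0 (n := 2 * k) (by omega) hx
  obtain ⟨j, rfl⟩ : ∃ j, k = j + 1 := ⟨k - 1, by omega⟩
  have h2 := eval_zero_derivative_gegenbauer_succ hα (2 * j + 1)
  rw [eval_zero_gegenbauer_odd, mul_zero] at h2
  rw [show 2 * (j + 1) = 2 * j + 1 + 1 by ring] at h ⊢
  rw [energy, h2] at h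
  simpa using h

theorem energy_zero_odd {α : ℝ} (hα : -1 / 2 < α) (k : ℕ) :
    energy α (2 * k + 1) 0 = ((2 * k + 1) * (gegenbauer α (2 * k)).eval 0) ^ 2 /
      (((2 * k : ℕ) + 1) * (2 * α + (2 * k : ℕ) + 1)) := by
  rw [energy, eval_zero_derivative_gegenbauer_succ hα, eval_zero_gegenbauer_odd]
  push_cast
  rw [show (2 * α + 2 * (k : ℝ) + 1) = 2 * k + 1 + 2 * α by ring]
  ring

/-- For `α < 0` and odd degree the maximum of `|C_n|` lies strictly below its energy bound. -/
theorem exists_abs_eval_gegenbauer_odd_le {α : ℝ} (hα : -1 / 2 < α) (hα0 : α < 0) (k : ℕ) :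
    ∃ M < (2 * k + 1) * |(gegenbauer α (2 * k)).eval 0| /
        √(((2 * k : ℕ) + 1) * (2 * α + (2 * k : ℕ) + 1)),
      ∀ x : ℝ, |x| ≤ 1 → |(gegenbauer α (2 * k + 1)).eval x| ≤ M := by
  -- Compactness turns the pointwise strict inequality into a gap uniform in `x`, which survives
  -- integration.
  obtain ⟨x, hx, hmax⟩ := (isCompact_Icc (a := (-1 : ℝ)) (b := 1)).exists_isMaxOn
    (Set.nonempty_Icc.2 (by norm_num))
    (f := fun x => |(gegenbauer α (2 * k + 1)).eval x|) (by fun_prop)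
  refine ⟨_, ?_, fun y hy => hmax (abs_le.1 hy)⟩
  have hlt : (gegenbauer α (2 * k + 1)).eval x ^ 2 < energy α (2 * k + 1) 0 := by
    -- At the origin the strict energy inequality is not available, but there the polynomial
    -- vanishes while the energy is at least `1`.
    rcases eq_or_ne x 0 with rfl | hx0
    · rw [eval_zero_gegenbauer_odd]
      have := one_le_energy_zero hα hα0 (n := 2 * k + 1) (by omega)
      linarith [zero_pow (M₀ := ℝ) two_ne_zero]
    · exact sq_eval_gegenbauer_lt_energy_zero hα hα0 (by omega) hx0 (abs_le.2 hx)
  rw [energy_zero_odd hα] at hlt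
  have h := Real.sqrt_lt_sqrt (sq_nonneg _) hlt
  rwa [Real.sqrt_sq_eq_abs, Real.sqrt_div (sq_nonneg _), Real.sqrt_sq_eq_abs, abs_mul,
    abs_of_pos (by positivity : (0 : ℝ) < 2 * k + 1)] at h

/-! ### Values at the origin -/

/-- `k!` times this binomial is the rising factorial `β(β+1)⋯(β+k-1)`. -/
theorem succ_mul_choose_succ (β : ℝ) (k : ℕ) :
    ((k : ℝ) + 1) * Ring.choose (((k + 1 : ℕ) : ℝ) + β - 1) (k + 1) =
      (k + β) * Ring.choose ((k : ℝ) + β - 1) k := by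
  have key : ∀ j : ℕ, (j.factorial : ℝ) * Ring.choose ((j : ℝ) + β - 1) j =
      (ascPochhammer ℝ j).eval β := by
    intro j
    rw [add_comm (j : ℝ), ← Ring.multichoose_eq, ← nsmul_eq_mul,
      Ring.factorial_nsmul_multichoose_eq_ascPochhammer, Polynomial.ascPochhammer_smeval_eq_eval]
  have h1 := key (k + 1)
  have hf : (k.factorial : ℝ) ≠ 0 := by positivity
  rw [ascPochhammer_succ_right, Polynomial.eval_mul, ← key k, Nat.factorial_succ] at h1
  apply mul_left_cancel₀ hf
  simp only [Polynomial.eval_add, Polynomial.eval_X, Polynomial.eval_natCast] at h1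
  push_cast at h1 ⊢
  linear_combination h1

theorem choose_mul_Gamma {β : ℝ} (hβ : ∀ j : ℕ, (j : ℝ) + β ≠ 0) (k : ℕ) :
    Ring.choose ((k : ℝ) + β - 1) k * (Real.Gamma β * k.factorial) = Real.Gamma (k + β) := by
  induction k with
  | zero => simp
  | succ k ih =>
    have h := succ_mul_choose_succ β k
    have e : Real.Gamma (((k + 1 : ℕ) : ℝ) + β) = (k + β) * Real.Gamma (k + β) := by
      rw [← Real.Gamma_add_one (hβ k)]; congr 1; push_cast; ring
    rw [e, ← ih, Nat.factorial_succ]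
    push_cast at h ⊢
    linear_combination Real.Gamma β * k.factorial * h

/-- At `0` the recurrence loses its middle term: each step of two degrees multiplies the absolute
value by `(2k+1)/(2k+1+2α)`. -/
theorem abs_eval_zero_gegenbauer_even {α : ℝ} (hα : -1 / 2 < α) (k : ℕ) :
    |(gegenbauer α (2 * k)).eval 0| =
      (2 * k).factorial * Real.Gamma (2 * α + 1) / Real.Gamma (2 * k + 2 * α + 1) *
        Ring.choose ((k : ℝ) + α) k := by
  have h2 : 0 < Real.Gamma (2 * α + 1) := Real.Gamma_pos_of_pos (by linarith)
  induction k with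
  | zero => simp [gegenbauer, h2.ne']
  | succ k ih =>
    have hk : (0 : ℝ) ≤ k := k.cast_nonneg
    have h3 : 0 < Real.Gamma (2 * k + 2 * α + 1) := Real.Gamma_pos_of_pos (by linarith)
    have h4 : (0 : ℝ) < 2 * k + 1 + 2 * α := by linarith
    have h5 : (0 : ℝ) < 2 * k + 2 + 2 * α := by linarith
    have hr := congrArg abs (eval_gegenbauer_recurrence hα (2 * k) 0)
    have hc := succ_mul_choose_succ (α + 1) k
    have e1 : Real.Gamma (2 * ((k + 1 : ℕ) : ℝ) + 2 * α + 1) =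
        (2 * k + 2 + 2 * α) * ((2 * k + 1 + 2 * α) * Real.Gamma (2 * k + 2 * α + 1)) := by
      rw [show (2 * (k : ℝ) + 1 + 2 * α) = 2 * k + 2 * α + 1 by ring,
        ← Real.Gamma_add_one (by linarith),
        show (2 * (k : ℝ) + 2 + 2 * α) = 2 * k + 2 * α + 1 + 1 by ring,
        ← Real.Gamma_add_one (by linarith)]
      congr 1; push_cast; ring
    have e2 : ((k : ℝ) + (α + 1) - 1) = k + α := by ring
    have e3 : (((k + 1 : ℕ) : ℝ) + (α + 1) - 1) = ((k + 1 : ℕ) : ℝ) + α := by ring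
    rw [e2, e3] at hc
    push_cast at hr
    rw [mul_zero, zero_mul, zero_sub, abs_neg, abs_mul, abs_mul, abs_of_pos h4,
      abs_of_pos (by positivity : (0 : ℝ) < 2 * k + 1), ih] at hr
    rw [e1, show 2 * (k + 1) = 2 * k + 2 by ring, Nat.factorial_succ, Nat.factorial_succ]
    apply mul_left_cancel₀ h4.ne'
    rw [hr]
    push_cast at hc ⊢
    generalize Real.Gamma (2 * k + 2 * α + 1) = g at *
    generalize 2 * (k : ℝ) + 1 + 2 * α = b at *
    have h6 : (k : ℝ) + 1 + α ≠ 0 := by linarith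
    rw [show 2 * (k : ℝ) + 2 + 2 * α = 2 * (k + 1 + α) by ring]
    field_simp
    linear_combination (-2 : ℝ) * hc

/-- The same value in the shape needed for odd `m`. For `-1/2 < α < 0` and `k ≥ 1` both `Γ(2α)` and
the new binomial are negative, hence the absolute values. -/
theorem abs_eval_zero_gegenbauer_even' {α : ℝ} (hα : -1 / 2 < α) (hα0 : α < 0) {k : ℕ}
    (hk : 1 ≤ k) :
    |(gegenbauer α (2 * k)).eval 0| =
      (2 * k).factorial * |Real.Gamma (2 * α)| / Real.Gamma (2 * k + 2 * α) *
        |Ring.choose ((k : ℝ) + α - 1) k| := by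
  have hk' : (1 : ℝ) ≤ k := by exact_mod_cast hk
  have hj : ∀ β : ℝ, -1 < β → β < 0 → ∀ j : ℕ, (j : ℝ) + β ≠ 0 := by
    intro β h1 h2 j
    rcases Nat.eq_zero_or_pos j with rfl | hj
    · simpa using h2.ne
    · have : (1 : ℝ) ≤ j := by exact_mod_cast hj
      linarith
  have h1 := choose_mul_Gamma (hj α (by linarith) hα0) k
  have h2 := choose_mul_Gamma (β := α + 1) (fun j => by
    have : (0 : ℝ) ≤ j := j.cast_nonneg
    linarith) k
  have hG1 : 0 < Real.Gamma (k + α) := Real.Gamma_pos_of_pos (by linarith)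
  have hG2 : 0 < Real.Gamma (α + 1) := Real.Gamma_pos_of_pos (by linarith)
  have hG3 : 0 < Real.Gamma (2 * α + 1) := Real.Gamma_pos_of_pos (by linarith)
  have hG4 : 0 < Real.Gamma (2 * k + 2 * α) := Real.Gamma_pos_of_pos (by linarith)
  have e1 : Real.Gamma (α + 1) = α * Real.Gamma α := Real.Gamma_add_one hα0.ne
  have e2 : Real.Gamma (k + (α + 1)) = (k + α) * Real.Gamma (k + α) := by
    rw [← add_assoc, Real.Gamma_add_one (by linarith)]
  have e3 : Real.Gamma (2 * α + 1) = 2 * α * Real.Gamma (2 * α) :=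
    Real.Gamma_add_one (by linarith)
  have e4 : Real.Gamma (2 * k + 2 * α + 1) = (2 * k + 2 * α) * Real.Gamma (2 * k + 2 * α) :=
    Real.Gamma_add_one (by linarith)
  rw [show (k : ℝ) + (α + 1) - 1 = k + α by ring, e2, ← h1] at h2
  have hf : (0 : ℝ) < k.factorial := by positivity
  have hΓ : Real.Gamma α ≠ 0 := fun h => by simp [h] at e1; linarith
  have h3 : α * Ring.choose ((k : ℝ) + α) k = (k + α) * Ring.choose ((k : ℝ) + α - 1) k := by
    apply mul_right_cancel₀ (mul_ne_zero hΓ hf.ne')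
    linear_combination h2 - Ring.choose ((k : ℝ) + α) k * k.factorial * e1
  have hΓ2 : Real.Gamma (2 * α) < 0 := by nlinarith
  have hch : Ring.choose ((k : ℝ) + α - 1) k < 0 := by
    have hΓ1 : Real.Gamma α < 0 := by nlinarith
    by_contra! hcon
    nlinarith [mul_nonneg hcon hf.le]
  have h5 : (k : ℝ) + α ≠ 0 := by linarith
  rw [abs_eval_zero_gegenbauer_even hα, e3, e4, abs_of_neg hΓ2, abs_of_neg hch]
  generalize Real.Gamma (2 * k + 2 * α) = g at *
  rw [show 2 * (k : ℝ) + 2 * α = 2 * (k + α) by ring]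
  field_simp
  linear_combination Real.Gamma (2 * α) * h3

end SGegenbauer

namespace SGegenbauer

/-! ### Orthogonality -/

/-- The integral of a polynomial against the Gegenbauer weight. -/
noncomputable def weightedIntegral (α : ℝ) (p : ℝ[X]) : ℝ :=
  ∫ x in (-1 : ℝ)..1, p.eval x * (1 - x ^ 2) ^ (α - 1 / 2)

/-- On `[0, 1]` the weight is `(1-x)^(α-1/2)`, with exponent above `-1`, times a continuous factor.
The other half follows by reflection. -/
theorem intervalIntegrable_weight {α : ℝ} (hα : -1 / 2 < α) :
    IntervalIntegrable (fun x : ℝ => (1 - x ^ 2) ^ (α - 1 / 2)) MeasureTheory.volume (-1) 1 := by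
  have h0 : IntervalIntegrable (fun x : ℝ => (1 - x ^ 2) ^ (α - 1 / 2))
      MeasureTheory.volume 0 1 := by
    have h1 : IntervalIntegrable (fun x : ℝ => x ^ (α - 1 / 2)) MeasureTheory.volume 1 0 :=
      intervalIntegral.intervalIntegrable_rpow' (by linarith)
    have h2 := h1.comp_sub_left 1
    rw [sub_self, sub_zero] at h2
    have h3 : ContinuousOn (fun x : ℝ => (1 + x) ^ (α - 1 / 2)) (Set.uIcc 0 1) := by
      refine ContinuousOn.rpow_const (by fun_prop) fun x hx => Or.inl ?_
      rw [Set.uIcc_of_le zero_le_one] at hx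
      linarith [hx.1]
    refine (h2.continuousOn_mul h3).congr ?_
    intro x hx
    rw [Set.uIoc_of_le zero_le_one] at hx
    have h4 : 0 ≤ 1 - x := by linarith [hx.2]
    have h5 : 0 ≤ 1 + x := by linarith [hx.1]
    simp only
    rw [← Real.mul_rpow h5 h4]
    congr 1
    ring
  have h1 := ((IntervalIntegrable.iff_comp_neg (by simp)).1 h0).symm
  simp only [neg_sq, neg_zero] at h1
  exact h1.trans h0

theorem intervalIntegrable_eval_mul_weight {α : ℝ} (hα : -1 / 2 < α) (p : ℝ[X]) :
    IntervalIntegrable (fun x : ℝ => p.eval x * (1 - x ^ 2) ^ (α - 1 / 2))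
      MeasureTheory.volume (-1) 1 :=
  (intervalIntegrable_weight hα).continuousOn_mul p.continuous.continuousOn

theorem weightedIntegral_sub {α : ℝ} (hα : -1 / 2 < α) (p q : ℝ[X]) :
    weightedIntegral α (p - q) = weightedIntegral α p - weightedIntegral α q := by
  rw [weightedIntegral, weightedIntegral, weightedIntegral,
    ← intervalIntegral.integral_sub (intervalIntegrable_eval_mul_weight hα p)
      (intervalIntegrable_eval_mul_weight hα q)]
  simp only [Polynomial.eval_sub, sub_mul]

theorem weightedIntegral_C_mul (α c : ℝ) (p : ℝ[X]) :
    weightedIntegral α (Polynomial.C c * p) = c * weightedIntegral α p := by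
  rw [weightedIntegral, weightedIntegral, ← intervalIntegral.integral_const_mul]
  simp only [Polynomial.eval_mul, Polynomial.eval_C, mul_assoc]

theorem normFactor_eq_weightedIntegral (α : ℝ) (n : ℕ) :
    normFactor α n = weightedIntegral α (gegenbauer α n * gegenbauer α n) := by
  simp only [normFactor, weightedIntegral, Polynomial.eval_mul, sq]

/-- Sturm-Liouville argument: by the differential equation, `(1-x²)^(α+1/2)` times the Wronskian has
derivative `c C_m C_n` times the weight, with `c` the difference of eigenvalues. It vanishes at `±1`
because `α + 1/2 > 0`. -/
theorem weightedIntegral_gegenbauer_mul_of_ne {α : ℝ} (hα : -1 / 2 < α) {m n : ℕ} (hmn : m ≠ n) :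
    weightedIntegral α (gegenbauer α m * gegenbauer α n) = 0 := by
  set W : ℝ[X] := Polynomial.derivative (gegenbauer α m) * gegenbauer α n
    - gegenbauer α m * Polynomial.derivative (gegenbauer α n) with hW
  set c : ℝ := n * (n + 2 * α) - m * (m + 2 * α) with hc
  have hc0 : c ≠ 0 := by
    have h1 : c = ((n : ℝ) - m) * (n + m + 2 * α) := by rw [hc]; ring
    have h2 : ((n : ℝ) - m) ≠ 0 := sub_ne_zero.2 (by exact_mod_cast hmn.symm)
    have h3 : (1 : ℝ) ≤ n + m := by exact_mod_cast (by omega : 1 ≤ n + m)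
    rw [h1]
    exact mul_ne_zero h2 (by linarith)
  have hderiv : ∀ x ∈ Set.Ioo (-1 : ℝ) 1,
      HasDerivAt (fun x : ℝ => (1 - x ^ 2) ^ (α + 1 / 2) * W.eval x)
        ((Polynomial.C c * (gegenbauer α m * gegenbauer α n)).eval x *
          (1 - x ^ 2) ^ (α - 1 / 2)) x := by
    intro x hx
    have hpos : 0 < 1 - x ^ 2 := by nlinarith [hx.1, hx.2]
    have h1 : HasDerivAt (fun x : ℝ => 1 - x ^ 2) (-(2 * x)) x := by
      simpa using (hasDerivAt_pow 2 x).const_sub 1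
    have h2 := (h1.rpow_const (p := α + 1 / 2) (Or.inl hpos.ne')).mul (W.hasDerivAt x)
    refine h2.congr_deriv ?_
    have e1 : (1 - x ^ 2) ^ (α + 1 / 2) = (1 - x ^ 2) ^ (α - 1 / 2) * (1 - x ^ 2) := by
      rw [← Real.rpow_add_one hpos.ne']
      congr 1
      ring
    have e2 : α + 1 / 2 - 1 = α - 1 / 2 := by ring
    have o1 := eval_gegenbauer_ode hα m x
    have o2 := eval_gegenbauer_ode hα n x
    rw [e1, e2]
    simp only [hW, hc, Polynomial.derivative_sub, Polynomial.derivative_mul, Polynomial.eval_sub,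
      Polynomial.eval_mul, Polynomial.eval_add, Polynomial.eval_C]
    linear_combination (1 - x ^ 2) ^ (α - 1 / 2) * ((gegenbauer α n).eval x * o1
      - (gegenbauer α m).eval x * o2)
  have hcont : ContinuousOn (fun x : ℝ => (1 - x ^ 2) ^ (α + 1 / 2) * W.eval x)
      (Set.Icc (-1) 1) := by
    refine ContinuousOn.mul ?_ W.continuous.continuousOn
    exact (Continuous.rpow_const (by fun_prop) fun x => Or.inr (by linarith)).continuousOn
  have key := intervalIntegral.integral_eq_sub_of_hasDerivAt_of_le (by norm_num) hcont hderiv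
    (intervalIntegrable_eval_mul_weight hα _)
  have h0 : (0 : ℝ) ^ (α + 1 / 2) = 0 := Real.zero_rpow (by linarith)
  have key2 : weightedIntegral α (Polynomial.C c * (gegenbauer α m * gegenbauer α n)) = 0 := by
    rw [weightedIntegral, key]
    simp only [neg_sq, one_pow, sub_self, h0, zero_mul]
  rw [weightedIntegral_C_mul] at key2
  exact (mul_eq_zero.1 key2).resolve_left hc0

/-- The first ratio is separate: the general relation continued to `n = -1` carries a factor `α` and
says nothing at `α = 0`. -/
theorem normFactor_one {α : ℝ} (hα : -1 / 2 < α) :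
    2 * (1 + α) * normFactor α 1 = normFactor α 0 := by
  have hr := congrArg (fun p => weightedIntegral α (p * gegenbauer α 0)) (gegenbauer_recurrence hα 0)
  have hX : Polynomial.X * gegenbauer α 1 * gegenbauer α 0 = gegenbauer α 1 * gegenbauer α 1 := by
    simp [gegenbauer]
  simp only [mul_assoc, sub_mul, weightedIntegral_C_mul, weightedIntegral_sub hα,
    weightedIntegral_gegenbauer_mul_of_ne hα (show 0 + 2 ≠ 0 by simp)] at hr
  rw [← mul_assoc Polynomial.X, zero_add, hX, ← normFactor_eq_weightedIntegral,
    ← normFactor_eq_weightedIntegral] at hr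
  push_cast at hr
  linarith

/-- Pairing two consecutive recurrences with `C_{n+2}` and `C_{n+1}` expresses both norms through
the same integral of `x C_{n+1} C_{n+2}`. -/
theorem normFactor_succ_succ {α : ℝ} (hα : -1 / 2 < α) (n : ℕ) :
    ((n : ℝ) + 1 + 2 * α) * (n + 2 + α) * normFactor α (n + 2) =
      (n + 1 + α) * (n + 2) * normFactor α (n + 1) := by
  have h1 := congrArg (fun p => weightedIntegral α (p * gegenbauer α (n + 2)))
    (gegenbauer_recurrence hα n)
  have h2 := congrArg (fun p => weightedIntegral α (p * gegenbauer α (n + 1)))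
    (gegenbauer_recurrence hα (n + 1))
  simp only [mul_assoc, sub_mul, weightedIntegral_C_mul, weightedIntegral_sub hα,
    weightedIntegral_gegenbauer_mul_of_ne hα (show n ≠ n + 2 by simp),
    ← normFactor_eq_weightedIntegral] at h1
  simp only [mul_assoc, sub_mul, weightedIntegral_C_mul, weightedIntegral_sub hα,
    weightedIntegral_gegenbauer_mul_of_ne hα (show n + 1 + 2 ≠ n + 1 by simp),
    ← normFactor_eq_weightedIntegral] at h2
  rw [show n + 1 + 1 = n + 2 from rfl, mul_comm (gegenbauer α (n + 2))] at h2
  push_cast at h2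
  linear_combination ((n : ℝ) + 2 + α) * h1 - ((n : ℝ) + 1 + α) * h2

theorem normFactor_pos {α : ℝ} (hα : -1 / 2 < α) (n : ℕ) : 0 < normFactor α n := by
  have h0 : 0 < normFactor α 0 := by
    simp only [normFactor, gegenbauer, Polynomial.eval_one, one_pow, one_mul]
    refine intervalIntegral.intervalIntegral_pos_of_pos_on (intervalIntegrable_weight hα)
      (fun x hx => ?_) (by norm_num)
    have : 0 < 1 - x ^ 2 := by nlinarith [hx.1, hx.2]
    positivity
  have h1 : 0 < normFactor α 1 := by
    have := normFactor_one hα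
    by_contra! h
    nlinarith
  cases n with
  | zero => exact h0
  | succ n =>
    induction n with
    | zero => exact h1
    | succ n ih =>
      have hn : (0 : ℝ) ≤ n := n.cast_nonneg
      have h2 := normFactor_succ_succ hα n
      have h3 : 0 < (n : ℝ) + 1 + α := by linarith
      have h4 : 0 < ((n : ℝ) + 1 + 2 * α) * (n + 2 + α) :=
        mul_pos (by linarith) (by linarith)
      have h5 : 0 < ((n : ℝ) + 1 + α) * (n + 2) * normFactor α (n + 1) := by positivity
      rw [← h2] at h5
      exact (mul_pos_iff_of_pos_left h4).1 h5

/-! ### The Christoffel-Darboux formula and the zeros -/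

/-- The Christoffel-Darboux formula, over any commutative real algebra. -/
theorem christoffel_darboux {A : Type*} [CommRing A] [Algebra ℝ A] {α : ℝ} (hα : -1 / 2 < α)
    (x y : A) (n : ℕ) :
    (x - y) * ∑ j ∈ Finset.range (n + 1), algebraMap ℝ A (normFactor α j)⁻¹ *
        (Polynomial.aeval x (gegenbauer α j) * Polynomial.aeval y (gegenbauer α j)) =
      algebraMap ℝ A ((n + 1) / (2 * (n + 1 + α) * normFactor α (n + 1))) *
        (Polynomial.aeval x (gegenbauer α (n + 1)) * Polynomial.aeval y (gegenbauer α n)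
          - Polynomial.aeval x (gegenbauer α n) * Polynomial.aeval y (gegenbauer α (n + 1))) := by
  induction n with
  | zero =>
    have h := normFactor_one hα
    simp only [zero_add, Finset.range_one, Finset.sum_singleton, Nat.cast_zero]
    rw [← h]
    simp [gegenbauer]
    ring
  | succ n ih =>
    have hn : (0 : ℝ) ≤ n := n.cast_nonneg
    have hx := congrArg (Polynomial.aeval x) (gegenbauer_recurrence hα n)
    have hy := congrArg (Polynomial.aeval y) (gegenbauer_recurrence hα n)
    have hp := normFactor_pos hα (n + 1)
    have hp2 := normFactor_pos hα (n + 2)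
    have hr := normFactor_succ_succ hα n
    have h3 : 0 < (n : ℝ) + 1 + α := by linarith
    have h4 : 0 < (n : ℝ) + 2 + α := by linarith
    -- In units of `d` the three coefficients become `n+1`, `2(n+1+α)` and `n+1+2α`, those of the
    -- recurrence. The step is then a cross-combination of the recurrences at `x` and `y`.
    set d : ℝ := 1 / (2 * (n + 1 + α) * normFactor α (n + 1)) with hd
    have e1 : ((n : ℝ) + 1) / (2 * (n + 1 + α) * normFactor α (n + 1)) = (n + 1) * d := by
      rw [hd]; ring
    have e2 : (normFactor α (n + 1))⁻¹ = 2 * (n + 1 + α) * d := by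
      rw [hd]; field_simp
    have e3 : (((n + 1 : ℕ) : ℝ) + 1) /
        (2 * (((n + 1 : ℕ) : ℝ) + 1 + α) * normFactor α (n + 1 + 1)) =
        (n + 1 + 2 * α) * d := by
      rw [hd, show ((n + 1 : ℕ) : ℝ) + 1 + α = n + 2 + α by push_cast; ring]
      push_cast
      field_simp
      linear_combination -hr
    rw [Finset.sum_range_succ, mul_add, ih, e1, e2, e3]
    simp only [map_mul, map_sub, Polynomial.aeval_C, Polynomial.aeval_X] at hx hy ⊢
    linear_combination (algebraMap ℝ A d) *
      (Polynomial.aeval x (gegenbauer α (n + 1)) * hy -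
        Polynomial.aeval y (gegenbauer α (n + 1)) * hx)

theorem christoffel_sum_pos {α : ℝ} (hα : -1 / 2 < α) (m : ℕ) (t : ℝ) :
    0 < ∑ j ∈ Finset.range (m + 1), (normFactor α j)⁻¹ * ((gegenbauer α j).eval t) ^ 2 := by
  refine Finset.sum_pos' (fun j _ => ?_) ⟨0, by simp, ?_⟩
  · have := normFactor_pos hα j
    positivity
  · simpa [gegenbauer] using normFactor_pos hα 0

/-- At `z` and its conjugate the right side of Christoffel-Darboux vanishes, while the sum is one of
nonnegative terms `|C_j(z)|²/λ_j` with a positive term at `j = 0`. -/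
theorem conj_eq_of_aeval_gegenbauer_eq_zero {α : ℝ} (hα : -1 / 2 < α) {m : ℕ} {z : ℂ}
    (hz : Polynomial.aeval z (gegenbauer α (m + 1)) = 0) : (starRingEnd ℂ) z = z := by
  have h := christoffel_darboux hα z ((starRingEnd ℂ) z) m
  simp only [Polynomial.aeval_conj, hz, map_zero, zero_mul, mul_zero, sub_zero,
    Complex.mul_conj] at h
  have h2 : (∑ j ∈ Finset.range (m + 1), algebraMap ℝ ℂ (normFactor α j)⁻¹ *
      (Complex.normSq (Polynomial.aeval z (gegenbauer α j)) : ℂ)) ≠ 0 := by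
    have : 0 < ∑ j ∈ Finset.range (m + 1), (normFactor α j)⁻¹ *
        Complex.normSq (Polynomial.aeval z (gegenbauer α j)) := by
      refine Finset.sum_pos' (fun j _ => ?_) ⟨0, by simp, ?_⟩
      · have := normFactor_pos hα j
        have := Complex.normSq_nonneg (Polynomial.aeval z (gegenbauer α j))
        positivity
      · simpa [gegenbauer] using normFactor_pos hα 0
    intro h0
    simp only [Complex.coe_algebraMap] at h0
    exact this.ne' (by exact_mod_cast h0)
  exact (sub_eq_zero.1 ((mul_eq_zero.1 h).resolve_right h2)).symm

-- Differentiating Christoffel-Darboux in `X` with second point `t`, then setting `X = t`, leaves a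
-- positive sum on the left and a multiple of `C_{m+1}'(t)` on the right.
open Polynomial in
theorem eval_derivative_gegenbauer_ne_zero {α : ℝ} (hα : -1 / 2 < α) {m : ℕ} {t : ℝ}
    (ht : (gegenbauer α (m + 1)).eval t = 0) :
    (derivative (gegenbauer α (m + 1))).eval t ≠ 0 := by
  intro hd
  have h := congrArg (fun p => eval t (derivative p)) (christoffel_darboux hα X (C t) m)
  have e : ∀ p : ℝ[X], aeval (C t) p = C (p.eval t) := fun p => by
    rw [← algebraMap_eq, aeval_algebraMap_apply_eq_algebraMap_eval]
  simp only [aeval_X_left_apply, e, ht, map_zero, mul_zero, sub_zero, algebraMap_eq,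
    derivative_mul, derivative_sub, derivative_X, derivative_C, eval_add, eval_mul, eval_sub,
    eval_X, eval_C, sub_self, zero_mul, add_zero, zero_add, hd, one_mul, eval_finsetSum]
    at h
  have := christoffel_sum_pos hα m t
  simp only [sq, h] at this
  exact lt_irrefl _ this

theorem card_roots_gegenbauer {α : ℝ} (hα : -1 / 2 < α) (m : ℕ) :
    (gegenbauer α (m + 1)).roots.toFinset.card = m + 1 := by
  set p := gegenbauer α (m + 1) with hp
  have hp0 : p ≠ 0 := gegenbauer_ne_zero hα _
  set q := p.map (algebraMap ℝ ℂ) with hq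
  have hq0 : q ≠ 0 := (Polynomial.map_ne_zero_iff (algebraMap ℝ ℂ).injective).2 hp0
  have hreal : ∀ z : ℂ, q.IsRoot z → ∃ t : ℝ, p.eval t = 0 ∧ (t : ℂ) = z := by
    intro z hz
    have hz' : Polynomial.aeval z p = 0 := by
      rwa [Polynomial.IsRoot, hq, Polynomial.eval_map_algebraMap] at hz
    obtain ⟨t, rfl⟩ := Complex.conj_eq_iff_real.1 (conj_eq_of_aeval_gegenbauer_eq_zero hα hz')
    refine ⟨t, ?_, rfl⟩
    have h2 := Polynomial.aeval_algebraMap_apply_eq_algebraMap_eval (A := ℂ) t p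
    rw [Complex.coe_algebraMap, hz'] at h2
    exact_mod_cast h2.symm
  have hnodup : q.roots.Nodup := by
    rw [Multiset.nodup_iff_count_le_one]
    intro z
    rw [Polynomial.count_roots]
    by_contra! hcon
    obtain ⟨h1, h2⟩ := (Polynomial.one_lt_rootMultiplicity_iff_isRoot hq0).1 hcon
    obtain ⟨t, ht, rfl⟩ := hreal z h1
    apply eval_derivative_gegenbauer_ne_zero hα ht
    rw [hq, Polynomial.derivative_map, Polynomial.IsRoot, Polynomial.eval_map_algebraMap,
      ← Complex.coe_algebraMap, Polynomial.aeval_algebraMap_apply_eq_algebraMap_eval] at h2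
    exact (map_eq_zero_iff _ (algebraMap ℝ ℂ).injective).1 h2
  have hcard : q.roots.toFinset.card = m + 1 := by
    rw [Multiset.toFinset_card_of_nodup hnodup, IsAlgClosed.card_roots_eq_natDegree, hq,
      Polynomial.natDegree_map, natDegree_gegenbauer hα]
  apply le_antisymm
  · calc _ ≤ Multiset.card p.roots := Multiset.toFinset_card_le _
      _ ≤ p.natDegree := p.card_roots'
      _ = m + 1 := natDegree_gegenbauer hα _
  · rw [← hcard]
    refine (Finset.card_le_card (t := p.roots.toFinset.image (fun t : ℝ => (t : ℂ))) ?_).trans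
      Finset.card_image_le
    intro z hz
    rw [Multiset.mem_toFinset, Polynomial.mem_roots hq0] at hz
    obtain ⟨t, ht, rfl⟩ := hreal z hz
    exact Finset.mem_image_of_mem _ (by
      rw [Multiset.mem_toFinset, Polynomial.mem_roots hp0]; exact ht)

end SGegenbauer

/-! ### Rolle's theorem and the error of polynomial interpolation -/

theorem exists_derivWithin_Icc_eq {a b : ℝ} {f : ℝ → ℝ} (hf : DifferentiableOn ℝ f (Set.Icc a b))
    (q : ℝ[X]) {s t : ℝ} (hs : a ≤ s) (ht : t ≤ b) (hst : s < t) (h1 : f s = q.eval s)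
    (h2 : f t = q.eval t) :
    ∃ ξ ∈ Set.Ioo s t, derivWithin f (Set.Icc a b) ξ = (Polynomial.derivative q).eval ξ := by
  have hd : ∀ x ∈ Set.Ioo s t, HasDerivAt (fun x => f x - q.eval x)
      (derivWithin f (Set.Icc a b) x - (Polynomial.derivative q).eval x) x := by
    intro x hx
    have hn : Set.Icc a b ∈ nhds x :=
      Icc_mem_nhds (hs.trans_lt hx.1) (hx.2.trans_le ht)
    have h3 := ((hf x (mem_of_mem_nhds hn)).hasDerivWithinAt).hasDerivAt hn
    exact h3.sub (q.hasDerivAt x)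
  have hc : ContinuousOn (fun x => f x - q.eval x) (Set.Icc s t) :=
    (hf.continuousOn.mono (Set.Icc_subset_Icc hs ht)).sub q.continuous.continuousOn
  obtain ⟨ξ, hξ, h3⟩ := exists_hasDerivAt_eq_zero hst hc (by simp only [h1, h2, sub_self]) hd
  exact ⟨ξ, hξ, sub_eq_zero.1 h3⟩

/-- Generalized Rolle theorem: if `f` agrees with a polynomial of degree at most `k` at `k + 1`
points, the `k`-th derivative of `f` agrees somewhere with that of the polynomial. -/
theorem exists_iteratedDerivWithin_Icc_eq {a b : ℝ} (hab : a < b) (k : ℕ) (f : ℝ → ℝ) (q : ℝ[X])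
    (hf : ContDiffOn ℝ (k : WithTop ℕ∞) f (Set.Icc a b)) (hq : q.natDegree ≤ k)
    (u : Fin (k + 1) → ℝ) (hu : StrictMono u) (hmem : ∀ i, u i ∈ Set.Icc a b)
    (heq : ∀ i, f (u i) = q.eval (u i)) :
    ∃ ξ ∈ Set.Icc a b, iteratedDerivWithin k f (Set.Icc a b) ξ = k.factorial * q.coeff k := by
  induction k generalizing f q with
  | zero =>
    refine ⟨u 0, hmem 0, ?_⟩
    rw [iteratedDerivWithin_zero, heq 0, Polynomial.eq_C_of_natDegree_le_zero hq]
    simp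
  | succ k ih =>
    have hd : DifferentiableOn ℝ f (Set.Icc a b) :=
      hf.differentiableOn (by exact_mod_cast Nat.succ_ne_zero k)
    have h1 : ∀ i : Fin (k + 1), ∃ ξ ∈ Set.Ioo (u i.castSucc) (u i.succ),
        derivWithin f (Set.Icc a b) ξ = (Polynomial.derivative q).eval ξ := fun i =>
      exists_derivWithin_Icc_eq hd q (hmem _).1 (hmem _).2 (hu (Fin.castSucc_lt_succ))
        (heq _) (heq _)
    choose v hv hveq using h1
    -- The new points interlace the old ones, one in each gap.
    have hvm : StrictMono v := by
      intro i j hij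
      exact ((hv i).2.trans_le (hu.monotone (Fin.succ_le_castSucc_iff.2 hij))).trans (hv j).1
    obtain ⟨ξ, hξ, h2⟩ := ih (derivWithin f (Set.Icc a b)) (Polynomial.derivative q)
      (hf.derivWithin (uniqueDiffOn_Icc hab) (by norm_cast))
      ((Polynomial.natDegree_derivative_le q).trans (by omega)) v hvm
      (fun i => ⟨(hmem _).1.trans (hv i).1.le, (hv i).2.le.trans (hmem _).2⟩) hveq
    refine ⟨ξ, hξ, ?_⟩
    rw [iteratedDerivWithin_succ', h2, Polynomial.coeff_derivative, Nat.factorial_succ]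
    push_cast
    ring

/-- The error of polynomial interpolation at the zeros of `w`. -/
theorem abs_sub_eval_interpolant_le {a b A : ℝ} (hab : a < b) {k : ℕ} {f : ℝ → ℝ} {p w : ℝ[X]}
    (hf : ContDiffOn ℝ (k : WithTop ℕ∞) f (Set.Icc a b))
    (hA : ∀ t ∈ Set.Icc a b, |iteratedDerivWithin k f (Set.Icc a b) t| ≤ A)
    (hp : p.natDegree < k) (hw : w.natDegree = k) {s : Finset ℝ} (hs : s.card = k)
    (hsub : ∀ z ∈ s, z ∈ Set.Icc a b) (hwz : ∀ z, w.eval z = 0 ↔ z ∈ s)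
    (hfp : ∀ z ∈ s, f z = p.eval z) {t : ℝ} (ht : t ∈ Set.Icc a b) :
    |f t - p.eval t| ≤ A / k.factorial * (|w.eval t| / |w.leadingCoeff|) := by
  by_cases hts : t ∈ s
  · rw [hfp t hts, (hwz t).2 hts]
    simp
  have hwt : w.eval t ≠ 0 := fun h => hts ((hwz t).1 h)
  have hl : w.leadingCoeff ≠ 0 := by
    rw [Polynomial.leadingCoeff_ne_zero]
    rintro rfl
    simp at hwt
  -- With this `c`, `p + c w` agrees with `f` at `t` as well as on `s`. Those are `k + 1` points,
  -- and its coefficient of degree `k` is `c` times the leading coefficient of `w`.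
  set c : ℝ := (f t - p.eval t) / w.eval t with hc
  have hcard : (insert t s).card = k + 1 := by rw [Finset.card_insert_of_notMem hts, hs]
  set u := (insert t s).orderEmbOfFin hcard with hu
  have humem : ∀ i, u i ∈ insert t s := fun i => Finset.orderEmbOfFin_mem _ hcard i
  obtain ⟨ξ, hξ, h⟩ := exists_iteratedDerivWithin_Icc_eq hab k f (p + Polynomial.C c * w) hf
    (by compute_degree; omega) u u.strictMono
    (fun i => by
      rcases Finset.mem_insert.1 (humem i) with h | h
      · rw [h]; exact ht
      · exact hsub _ h)
    (fun i => by
      rcases Finset.mem_insert.1 (humem i) with h | h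
      · rw [h, hc]; simp; field_simp; ring
      · simp [hfp _ h, (hwz _).2 h])
  have h1 := hA ξ hξ
  rw [h, Polynomial.coeff_add, Polynomial.coeff_eq_zero_of_natDegree_lt hp, zero_add,
    Polynomial.coeff_C_mul, ← hw, Polynomial.coeff_natDegree, hw, hc, abs_mul, abs_mul, abs_div,
    Nat.abs_cast] at h1
  have hk : (0 : ℝ) < k.factorial := by positivity
  have h2 : 0 < |w.eval t| := abs_pos.2 hwt
  have h3 : 0 < |w.leadingCoeff| := abs_pos.2 hl
  calc |f t - p.eval t| = (k.factorial * (|f t - p.eval t| / |w.eval t| * |w.leadingCoeff|)) /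
        k.factorial * (|w.eval t| / |w.leadingCoeff|) := by field_simp
    _ ≤ _ := by gcongr

namespace SGegenbauer

/-! ### The quadrature as the integral of an interpolating polynomial -/

theorem eval_shifted (L α : ℝ) (n : ℕ) (t : ℝ) :
    (shifted L α n).eval t = (gegenbauer α n).eval (2 * t / L - 1) := by
  simp [shifted, mul_div_right_comm]

theorem natDegree_shifted {L α : ℝ} (hL : 0 < L) (hα : -1 / 2 < α) (n : ℕ) :
    (shifted L α n).natDegree = n := by
  have h : (Polynomial.C (2 / L) * Polynomial.X - 1 : ℝ[X]).natDegree = 1 := by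
    rw [← Polynomial.C_1]
    exact (Polynomial.natDegree_sub_C).trans (Polynomial.natDegree_C_mul_X _ (by positivity))
  rw [shifted, Polynomial.natDegree_comp, h, natDegree_gegenbauer hα, mul_one]

theorem leadingCoeff_shifted {L α : ℝ} (hL : 0 < L) (hα : -1 / 2 < α) (n : ℕ) :
    (shifted L α n).leadingCoeff = leadCoeff α n * (2 / L) ^ n := by
  have h : (Polynomial.C (2 / L) * Polynomial.X - 1 : ℝ[X]).natDegree = 1 := by
    rw [← Polynomial.C_1]
    exact (Polynomial.natDegree_sub_C).trans (Polynomial.natDegree_C_mul_X _ (by positivity))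
  have h2 : (Polynomial.C (2 / L) * Polynomial.X - 1 : ℝ[X]).leadingCoeff = 2 / L := by
    rw [Polynomial.leadingCoeff, h, ← Polynomial.C_1]
    simp [-map_one, Polynomial.coeff_C]
  rw [shifted, Polynomial.leadingCoeff_comp (by omega), h2, natDegree_gegenbauer hα, leadCoeff]

theorem shifted_ne_zero {L α : ℝ} (hL : 0 < L) (hα : -1 / 2 < α) (n : ℕ) : shifted L α n ≠ 0 := by
  rw [← Polynomial.leadingCoeff_ne_zero, leadingCoeff_shifted hL hα]
  have := leadCoeff_pos hα n
  positivity

theorem mem_nodes {L α : ℝ} (hL : 0 < L) (hα : -1 / 2 < α) {m : ℕ} {z : ℝ} :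
    z ∈ nodes L α m ↔ (shifted L α (m + 1)).eval z = 0 := by
  rw [nodes, Multiset.mem_toFinset, Polynomial.mem_roots (shifted_ne_zero hL hα _),
    Polynomial.IsRoot]

theorem mem_Icc_of_mem_nodes {L α : ℝ} (hL : 0 < L) (hα : -1 / 2 < α) {m : ℕ} {z : ℝ}
    (hz : z ∈ nodes L α m) : z ∈ Set.Icc 0 L := by
  rw [mem_nodes hL hα, eval_shifted] at hz
  obtain ⟨h1, h2⟩ := abs_lt.1 (abs_lt_one_of_isRoot_gegenbauer hα hz)
  have h3 : 2 * z / L * L = 2 * z := by field_simp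
  constructor <;> nlinarith

theorem card_nodes {L α : ℝ} (hL : 0 < L) (hα : -1 / 2 < α) (m : ℕ) :
    (nodes L α m).card = m + 1 := by
  have h : nodes L α m = (gegenbauer α (m + 1)).roots.toFinset.image fun t => L * (t + 1) / 2 := by
    ext z
    rw [mem_nodes hL hα, eval_shifted, Finset.mem_image]
    simp only [Multiset.mem_toFinset, Polynomial.mem_roots (gegenbauer_ne_zero hα _),
      Polynomial.IsRoot]
    constructor
    · intro hz
      exact ⟨_, hz, by field_simp; ring⟩
    · rintro ⟨t, ht, rfl⟩
      rw [← ht]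
      congr 1
      field_simp
      ring
  rw [h, Finset.card_image_of_injective, card_roots_gegenbauer hα]
  intro s t hst
  have : L * (s + 1) / 2 = L * (t + 1) / 2 := hst
  have h2 : L * (s - t) = 0 := by linarith
  linarith [(mul_eq_zero.1 h2).resolve_left hL.ne']

/-- The polynomial whose integral over `[0, y]` is the matrix entry of the node `z`. -/
noncomputable def nodeBasis (L α : ℝ) (m : ℕ) (z : ℝ) : ℝ[X] :=
  Polynomial.C (shiftedChristoffel L α m z) * ∑ j ∈ Finset.range (m + 1),
    Polynomial.C ((shiftedNormFactor L α j)⁻¹ * (shifted L α j).eval z) * shifted L α j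

theorem matrixEntry_eq_integral (L α : ℝ) (m : ℕ) (y z : ℝ) :
    matrixEntry L α m y z = ∫ t in (0 : ℝ)..y, (nodeBasis L α m z).eval t := by
  simp only [matrixEntry, nodeBasis, Polynomial.eval_mul, Polynomial.eval_C,
    Polynomial.eval_finsetSum]
  rw [intervalIntegral.integral_const_mul, intervalIntegral.integral_finsetSum]
  · simp only [intervalIntegral.integral_const_mul]
  · intro j _
    exact (Continuous.intervalIntegrable (by fun_prop) _ _)

/-- The powers of `L/2` cancel, leaving the Christoffel-Darboux kernel divided by its diagonal value
at the node. -/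
theorem eval_nodeBasis {L α : ℝ} (hL : 0 < L) (m : ℕ) (z t : ℝ) :
    (nodeBasis L α m z).eval t = christoffel α m (2 * z / L - 1) *
      ∑ j ∈ Finset.range (m + 1), (normFactor α j)⁻¹ *
        ((gegenbauer α j).eval (2 * z / L - 1) * (gegenbauer α j).eval (2 * t / L - 1)) := by
  simp only [nodeBasis, shiftedChristoffel, shiftedNormFactor, Polynomial.eval_mul,
    Polynomial.eval_C, Polynomial.eval_finsetSum, eval_shifted, Finset.mul_sum]
  refine Finset.sum_congr rfl fun j _ => ?_
  have h : (L / 2) ^ (2 * α) ≠ 0 := (Real.rpow_pos_of_pos (by positivity) _).ne'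
  rw [mul_inv]
  field_simp

theorem natDegree_nodeBasis_le {L α : ℝ} (hL : 0 < L) (hα : -1 / 2 < α) (m : ℕ) (z : ℝ) :
    (nodeBasis L α m z).natDegree ≤ m := by
  refine (Polynomial.natDegree_C_mul_le _ _).trans (Polynomial.natDegree_sum_le_of_forall_le _ _ ?_)
  intro j hj
  refine (Polynomial.natDegree_C_mul_le _ _).trans ?_
  rw [natDegree_shifted hL hα]
  exact Nat.lt_succ_iff.1 (Finset.mem_range.1 hj)

theorem eval_nodeBasis_self {L α : ℝ} (hL : 0 < L) (hα : -1 / 2 < α) (m : ℕ) (z : ℝ) :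
    (nodeBasis L α m z).eval z = 1 := by
  rw [eval_nodeBasis hL, christoffel]
  simp only [← sq]
  exact inv_mul_cancel₀ (christoffel_sum_pos hα m _).ne'

theorem eval_nodeBasis_of_ne {L α : ℝ} (hL : 0 < L) (hα : -1 / 2 < α) {m : ℕ} {z t : ℝ}
    (hz : z ∈ nodes L α m) (ht : t ∈ nodes L α m) (hzt : z ≠ t) :
    (nodeBasis L α m z).eval t = 0 := by
  rw [mem_nodes hL hα, eval_shifted] at hz ht
  have h := christoffel_darboux hα (2 * z / L - 1) (2 * t / L - 1) m
  simp only [Polynomial.coe_aeval_eq_eval, hz, ht, zero_mul, mul_zero, sub_zero,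
    Algebra.algebraMap_self, RingHom.id_apply] at h
  have h2 : 2 * z / L - 1 - (2 * t / L - 1) ≠ 0 := by
    intro h0
    apply hzt
    field_simp at h0
    linarith
  rw [eval_nodeBasis hL, (mul_eq_zero.1 h).resolve_left h2, mul_zero]

/-- The polynomial interpolating `f` at the nodes. -/
noncomputable def nodeInterpolant (L α : ℝ) (m : ℕ) (f : ℝ → ℝ) : ℝ[X] :=
  ∑ z ∈ nodes L α m, Polynomial.C (f z) * nodeBasis L α m z

theorem quadrature_eq_integral (L α : ℝ) (m : ℕ) (f : ℝ → ℝ) (y : ℝ) :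
    quadrature L α m f y = ∫ t in (0 : ℝ)..y, (nodeInterpolant L α m f).eval t := by
  simp only [quadrature, nodeInterpolant, Polynomial.eval_mul, Polynomial.eval_C,
    Polynomial.eval_finsetSum]
  rw [intervalIntegral.integral_finsetSum]
  · simp only [intervalIntegral.integral_const_mul, matrixEntry_eq_integral, mul_comm]
  · intro j _
    exact (Continuous.intervalIntegrable (by fun_prop) _ _)

theorem natDegree_nodeInterpolant_le {L α : ℝ} (hL : 0 < L) (hα : -1 / 2 < α) (m : ℕ)
    (f : ℝ → ℝ) : (nodeInterpolant L α m f).natDegree ≤ m :=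
  Polynomial.natDegree_sum_le_of_forall_le _ _ fun z _ =>
    (Polynomial.natDegree_C_mul_le _ _).trans (natDegree_nodeBasis_le hL hα m z)

theorem eval_nodeInterpolant {L α : ℝ} (hL : 0 < L) (hα : -1 / 2 < α) {m : ℕ} (f : ℝ → ℝ) {z : ℝ}
    (hz : z ∈ nodes L α m) : (nodeInterpolant L α m f).eval z = f z := by
  simp only [nodeInterpolant, Polynomial.eval_mul, Polynomial.eval_C, Polynomial.eval_finsetSum]
  rw [Finset.sum_eq_single_of_mem z hz fun t ht htz => by
    rw [eval_nodeBasis_of_ne hL hα ht hz htz, mul_zero], eval_nodeBasis_self hL hα, mul_one]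

theorem abs_two_mul_div_sub_one_le {L t : ℝ} (hL : 0 < L) (ht : t ∈ Set.Icc 0 L) :
    |2 * t / L - 1| ≤ 1 := by
  have h1 : 0 ≤ t / L := div_nonneg ht.1 hL.le
  have h2 : t / L ≤ 1 := (div_le_one hL).2 ht.2
  rw [mul_div_assoc, abs_le]
  constructor <;> linarith

/-- Integrated interpolation error. `M` stays free so that all signs of `α` and parities of `m`
share this estimate. -/
theorem abs_quadError_le {L A α M y : ℝ} {m : ℕ} {f : ℝ → ℝ} (hL : 0 < L) (hA0 : 0 ≤ A)
    (hα : -1 / 2 < α) (hf : ContDiffOn ℝ ((m + 1 : ℕ) : WithTop ℕ∞) f (Set.Icc 0 L))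
    (hA : ∀ t ∈ Set.Icc 0 L, |iteratedDerivWithin (m + 1) f (Set.Icc 0 L) t| ≤ A)
    (hy : y ∈ Set.Icc 0 L)
    (hM : ∀ x : ℝ, |x| ≤ 1 → |(gegenbauer α (m + 1)).eval x| ≤ M) :
    |quadError L α m f y| ≤
      A / (m + 1).factorial * (M / (leadCoeff α (m + 1) * (2 / L) ^ (m + 1))) * y := by
  have hK := leadCoeff_pos hα (m + 1)
  have hfc : ContinuousOn f (Set.uIcc 0 y) := by
    rw [Set.uIcc_of_le hy.1]
    exact hf.continuousOn.mono (Set.Icc_subset_Icc_right hy.2)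
  have h : quadError L α m f y =
      ∫ t in (0 : ℝ)..y, (f t - (nodeInterpolant L α m f).eval t) := by
    rw [quadError, quadrature_eq_integral, intervalIntegral.integral_sub hfc.intervalIntegrable
      (Continuous.intervalIntegrable (by fun_prop) _ _)]
  have hb := intervalIntegral.norm_integral_le_of_norm_le_const (a := 0) (b := y)
    (f := fun t => f t - (nodeInterpolant L α m f).eval t)
    (C := A / (m + 1).factorial * (M / (leadCoeff α (m + 1) * (2 / L) ^ (m + 1)))) (by
      intro t ht
      rw [Set.uIoc_of_le hy.1] at ht
      have ht' : t ∈ Set.Icc 0 L := ⟨ht.1.le, ht.2.trans hy.2⟩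
      have h1 := abs_sub_eval_interpolant_le hL hf hA
        (Nat.lt_succ_of_le (natDegree_nodeInterpolant_le hL hα m f))
        (natDegree_shifted hL hα (m + 1)) (card_nodes hL hα m)
        (fun z hz => mem_Icc_of_mem_nodes hL hα hz) (fun z => (mem_nodes hL hα).symm)
        (fun z hz => (eval_nodeInterpolant hL hα f hz).symm) ht'
      rw [Real.norm_eq_abs]
      refine h1.trans ?_
      rw [leadingCoeff_shifted hL hα, eval_shifted,
        abs_of_pos (by positivity : 0 < leadCoeff α (m + 1) * (2 / L) ^ (m + 1))]
      gcongr
      exact hM _ (abs_two_mul_div_sub_one_le hL ht'))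
  rw [h]
  simpa only [Real.norm_eq_abs, sub_zero, abs_of_nonneg hy.1] using hb

theorem interpolation_factor_eq_Gamma {L A α M y : ℝ} (hL : 0 < L) (hα : -1 / 2 < α) (m : ℕ) :
    A / (m + 1).factorial * (M / (leadCoeff α (m + 1) * (2 / L) ^ (m + 1))) * y =
      A * (2 : ℝ) ^ (-2 * (m : ℤ) - 1) * Real.Gamma (α + 1) * y * L ^ (m + 1) *
        Real.Gamma (m + 2 * α + 1) /
        (Real.Gamma (2 * α + 1) * Real.Gamma (m + 2) * Real.Gamma (m + α + 1)) * M := by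
  have hm : (0 : ℝ) ≤ m := m.cast_nonneg
  have h1 : 0 < Real.Gamma (α + 1) := Real.Gamma_pos_of_pos (by linarith)
  have h2 : 0 < Real.Gamma (2 * α + 1) := Real.Gamma_pos_of_pos (by linarith)
  have h3 : 0 < Real.Gamma (m + 2 * α + 1) := Real.Gamma_pos_of_pos (by linarith)
  have h4 : 0 < Real.Gamma (m + α + 1) := Real.Gamma_pos_of_pos (by linarith)
  have h5 : Real.Gamma (m + 2) = (m + 1).factorial := by
    rw [← Real.Gamma_nat_eq_factorial]; congr 1; push_cast; ring
  have h6 : (2 : ℝ) ^ (-2 * (m : ℤ) - 1) = 1 / (2 ^ m * 2 ^ m * 2) := by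
    rw [zpow_sub₀ two_ne_zero, neg_mul, zpow_neg, two_mul, zpow_add₀ two_ne_zero, zpow_natCast]
    field_simp
  have h7 : (0 : ℝ) < (m + 1).factorial := by positivity
  rw [h5, h6, leadCoeff_eq_Gamma hα, div_pow, pow_succ 2 m]
  generalize ((m + 1).factorial : ℝ) = a at *
  generalize Real.Gamma (m + 2 * α + 1) = b at *
  generalize Real.Gamma (m + α + 1) = c at *
  generalize Real.Gamma (2 * α + 1) = d at *
  generalize Real.Gamma (α + 1) = e at *
  field_simp

end SGegenbauer

/-! ### Growth of the Gamma function -/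

/-- A convergent sequence with nonzero limit is bounded, and so is its inverse. Index `0` is left
out because Euler's sequence for Gamma can vanish there. -/
theorem exists_bounds_of_tendsto_pos {u : ℕ → ℝ} {g : ℝ} (hg : 0 < g)
    (hu : Filter.Tendsto u Filter.atTop (nhds g)) (hpos : ∀ n, 1 ≤ n → 0 < u n) :
    ∃ c > 0, ∀ n, 1 ≤ n → u n ≤ c ∧ 1 ≤ c * u n := by
  obtain ⟨a, ha⟩ := hu.bddAbove_range
  obtain ⟨b, hb⟩ := (hu.inv₀ hg.ne').bddAbove_range
  have ha' : ∀ n, u n ≤ a := fun n => ha ⟨n, rfl⟩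
  have hb' : ∀ n, (u n)⁻¹ ≤ b := fun n => hb ⟨n, rfl⟩
  refine ⟨max a b, ((hpos 1 le_rfl).trans_le (ha' 1)).trans_le (le_max_left _ _),
    fun n hn => ⟨(ha' n).trans (le_max_left _ _), ?_⟩⟩
  rw [← inv_le_iff_one_le_mul₀ (hpos n hn)]
  exact (hb' n).trans (le_max_right _ _)

theorem Real.GammaSeq_mul_Gamma {s : ℝ} (hs : 0 < s) (n : ℕ) :
    Real.GammaSeq s n * Real.Gamma (s + n + 1) = (n : ℝ) ^ s * n.factorial * Real.Gamma s := by
  have h : ∀ n : ℕ, (∏ j ∈ Finset.range n, (s + j)) * Real.Gamma s = Real.Gamma (s + n) := by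
    intro n
    induction n with
    | zero => simp
    | succ n ih =>
      have : s + (n : ℝ) ≠ 0 := by positivity
      rw [Finset.prod_range_succ, mul_right_comm, ih, mul_comm, ← Real.Gamma_add_one this]
      push_cast
      ring_nf
  have h2 := h (n + 1)
  have h3 : 0 < ∏ j ∈ Finset.range (n + 1), (s + j) := Finset.prod_pos fun j _ => by positivity
  push_cast at h2
  rw [add_assoc, ← h2, Real.GammaSeq]
  field_simp

/-- Euler's limit is applied at `s + 1`, which is positive even when `s` is not. The resulting
surplus factor `(n+s+1)/n` is bounded above and below. -/
theorem exists_Gamma_bounds {s : ℝ} (hs : -1 < s) :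
    ∃ c > 0, ∀ n : ℕ, 1 ≤ n →
      Real.Gamma (n + s + 1) ≤ c * ((n : ℝ) ^ s * n.factorial) ∧
        (n : ℝ) ^ s * n.factorial ≤ c * Real.Gamma (n + s + 1) := by
  have hs1 : 0 < s + 1 := by linarith
  have hg := Real.Gamma_pos_of_pos hs1
  obtain ⟨c, hc, h⟩ := exists_bounds_of_tendsto_pos hg (Real.GammaSeq_tendsto_Gamma (s + 1))
    (fun n hn => by
      have : (0 : ℝ) < n := by exact_mod_cast hn
      have : 0 < ∏ j ∈ Finset.range (n + 1), (s + 1 + j) :=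
        Finset.prod_pos fun j _ => by positivity
      rw [Real.GammaSeq]
      positivity)
  set g := Real.Gamma (s + 1) with hgdef
  -- The first summand serves the upper bound, the second the lower bound.
  refine ⟨c * g + c * (|s| + 2) / g, by positivity, fun n hn => ?_⟩
  have hn0 : (1 : ℝ) ≤ n := by exact_mod_cast hn
  have hn1 : (0 : ℝ) < n := by linarith
  obtain ⟨h1, h2⟩ := h n hn
  have h3 := Real.GammaSeq_mul_Gamma hs1 n
  rw [show s + 1 + n + 1 = (n + s + 1) + 1 by ring, Real.Gamma_add_one (by linarith),
    Real.rpow_add_one hn1.ne', ← hgdef] at h3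
  have hG : 0 < Real.Gamma (n + s + 1) := Real.Gamma_pos_of_pos (by linarith)
  set G := Real.Gamma (n + s + 1)
  set u := Real.GammaSeq (s + 1) n
  have hp : 0 < (n : ℝ) ^ s * n.factorial := by positivity
  set p := (n : ℝ) ^ s * n.factorial with hpdef
  have h3' : u * ((n + s + 1) * G) = p * n * g := by rw [h3, hpdef]; ring
  have hns : 0 < (n : ℝ) + s + 1 := by linarith
  have hu : 0 < u := by
    by_contra! hcon
    nlinarith
  constructor
  · have h4 : G ≤ c * g * p := by
      refine le_of_mul_le_mul_left ?_ hn1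
      calc (n : ℝ) * G ≤ (n + s + 1) * G := by gcongr; linarith
        _ = (n + s + 1) * G * 1 := by ring
        _ ≤ (n + s + 1) * G * (c * u) := by gcongr
        _ = c * (u * ((n + s + 1) * G)) := by ring
        _ = n * (c * g * p) := by rw [h3']; ring
    have : 0 ≤ c * (|s| + 2) / g * p := by positivity
    linarith
  · have h4 : p ≤ c * (|s| + 2) / g * G := by
      refine le_of_mul_le_mul_left ?_ (mul_pos hn1 hg)
      have h5 : (n : ℝ) + s + 1 ≤ (|s| + 2) * n := by
        nlinarith [le_abs_self s, abs_nonneg s]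
      calc (n : ℝ) * g * p = u * ((n + s + 1) * G) := by rw [h3']; ring
        _ ≤ c * ((|s| + 2) * n * G) := by gcongr
        _ = n * g * (c * (|s| + 2) / g * G) := by field_simp
    have : 0 ≤ c * g * G := by positivity
    linarith

theorem rpow_add_half_le_exp_mul_factorial {m : ℕ} (hm : 1 ≤ m) :
    (m : ℝ) ^ ((m : ℝ) + 1 / 2) ≤ Real.exp m * m.factorial := by
  have hm0 : (0 : ℝ) < m := by exact_mod_cast hm
  have h := Stirling.le_factorial_stirling m
  have h1 : √(m : ℝ) ≤ √(2 * Real.pi * m) :=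
    Real.sqrt_le_sqrt (by nlinarith [Real.pi_gt_three])
  rw [Real.rpow_add hm0, Real.rpow_natCast, ← Real.sqrt_eq_rpow]
  have h2 : √(m : ℝ) * ((m : ℝ) / Real.exp 1) ^ m ≤ m.factorial :=
    (mul_le_mul_of_nonneg_right h1 (by positivity)).trans h
  have h3 : Real.exp m = Real.exp 1 ^ m := by rw [← Real.exp_nat_mul, mul_one]
  calc (m : ℝ) ^ m * √m = Real.exp m * (√m * (m / Real.exp 1) ^ m) := by
        rw [h3, div_pow]; field_simp
    _ ≤ _ := by gcongr

/-- The common core of the asymptotic bounds: `Γ(m+α+1)` is comparable to `m^α m!`, which cancels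
`m^α`, and Stirling bounds `1/m!`. -/
theorem exists_rpow_div_Gamma_le {α : ℝ} (hα : -1 < α) :
    ∃ c > 0, ∀ m : ℕ, 1 ≤ m → (m : ℝ) ^ α / m / Real.Gamma (m + α + 1) ≤
      c * (Real.exp m / (m : ℝ) ^ ((m : ℝ) + 3 / 2)) := by
  obtain ⟨c, hc, h⟩ := exists_Gamma_bounds hα
  refine ⟨c, hc, fun m hm => ?_⟩
  have hm0 : (0 : ℝ) < m := by exact_mod_cast hm
  have h1 := (h m hm).2
  have h2 := rpow_add_half_le_exp_mul_factorial hm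
  have hG : 0 < Real.Gamma (m + α + 1) := Real.Gamma_pos_of_pos (by linarith)
  rw [show (m : ℝ) + 3 / 2 = m + 1 / 2 + 1 by ring, Real.rpow_add_one hm0.ne']
  have hq : 0 < (m : ℝ) ^ ((m : ℝ) + 1 / 2) := by positivity
  have ha : 0 < (m : ℝ) ^ α := by positivity
  rw [div_div, mul_div_assoc', div_le_div_iff₀ (by positivity) (by positivity)]
  calc (m : ℝ) ^ α * ((m : ℝ) ^ ((m : ℝ) + 1 / 2) * m) ≤
        (m : ℝ) ^ α * (Real.exp m * m.factorial * m) := by gcongr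
    _ = Real.exp m * m * ((m : ℝ) ^ α * m.factorial) := by ring
    _ ≤ Real.exp m * m * (c * Real.Gamma (m + α + 1)) := by gcongr
    _ = _ := by ring

/-- `Γ(m+2α+1)` supplies `m^(2α) m!`. One factor `m^α` is absorbed by `Γ(m+α+1)`, the other is the
`-α` in the final exponent. -/
theorem exists_Gamma_quotient_le {α : ℝ} (hα : -1 / 2 < α) :
    ∃ c > 0, ∀ m : ℕ, 1 ≤ m →
      Real.Gamma (α + 1) * Real.Gamma (m + 2 * α + 1) /
          (Real.Gamma (2 * α + 1) * Real.Gamma (m + 2) * Real.Gamma (m + α + 1)) ≤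
        c * (Real.exp m / (m : ℝ) ^ ((m : ℝ) + 3 / 2 - α)) := by
  obtain ⟨c, hc, h⟩ := exists_rpow_div_Gamma_le (α := α) (by linarith)
  obtain ⟨d, hd, h'⟩ := exists_Gamma_bounds (s := 2 * α) (by linarith)
  have hg1 : 0 < Real.Gamma (α + 1) := Real.Gamma_pos_of_pos (by linarith)
  have hg2 : 0 < Real.Gamma (2 * α + 1) := Real.Gamma_pos_of_pos (by linarith)
  refine ⟨Real.Gamma (α + 1) / Real.Gamma (2 * α + 1) * d * c, by positivity, fun m hm => ?_⟩
  have hm0 : (0 : ℝ) < m := by exact_mod_cast hm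
  have hG : 0 < Real.Gamma (m + α + 1) := Real.Gamma_pos_of_pos (by linarith)
  have h1 := (h' m hm).1
  have h2 := h m hm
  have ha : 0 < (m : ℝ) ^ α := by positivity
  have e1 : Real.Gamma (m + 2) = (m + 1) * m.factorial := by
    rw [← Real.Gamma_nat_eq_factorial, ← Real.Gamma_add_one (by positivity)]
    ring_nf
  rw [two_mul, Real.rpow_add hm0, ← two_mul] at h1
  rw [e1, Real.rpow_sub hm0]
  calc Real.Gamma (α + 1) * Real.Gamma (m + 2 * α + 1) /
        (Real.Gamma (2 * α + 1) * ((m + 1) * m.factorial) * Real.Gamma (m + α + 1)) ≤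
      Real.Gamma (α + 1) * (d * ((m : ℝ) ^ α * (m : ℝ) ^ α * m.factorial)) /
        (Real.Gamma (2 * α + 1) * (m * m.factorial) * Real.Gamma (m + α + 1)) := by
        gcongr
        linarith
    _ = Real.Gamma (α + 1) / Real.Gamma (2 * α + 1) * d * (m : ℝ) ^ α *
        ((m : ℝ) ^ α / m / Real.Gamma (m + α + 1)) := by field_simp
    _ ≤ Real.Gamma (α + 1) / Real.Gamma (2 * α + 1) * d * (m : ℝ) ^ α *
        (c * (Real.exp m / (m : ℝ) ^ ((m : ℝ) + 3 / 2))) := by gcongr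
    _ = _ := by field_simp

/-! ### Growth of the binomial factors -/

namespace SGegenbauer

theorem exists_choose_even_le {α : ℝ} (hα : -1 / 2 < α) :
    ∃ c > 0, ∀ m k : ℕ, 1 ≤ m → m = 2 * k →
      |Ring.choose ((k : ℝ) + α) k| ≤ c * (m : ℝ) ^ α := by
  obtain ⟨c, hc, h⟩ := exists_Gamma_bounds (s := α) (by linarith)
  have hg1 : 0 < Real.Gamma (α + 1) := Real.Gamma_pos_of_pos (by linarith)
  refine ⟨c / Real.Gamma (α + 1) / 2 ^ α, by positivity, ?_⟩
  rintro m k hm rfl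
  have h1 := choose_mul_Gamma (β := α + 1) (fun j => by
    have : (0 : ℝ) ≤ j := j.cast_nonneg
    linarith) k
  have h2 := (h k (by omega)).1
  have hf : (0 : ℝ) < k.factorial := by positivity
  have hG : 0 < Real.Gamma (k + α + 1) :=
    Real.Gamma_pos_of_pos (by have : (0 : ℝ) ≤ k := k.cast_nonneg; linarith)
  rw [show (k : ℝ) + (α + 1) - 1 = k + α by ring, ← add_assoc] at h1
  have h3 : Ring.choose ((k : ℝ) + α) k =
      Real.Gamma (k + α + 1) / (Real.Gamma (α + 1) * k.factorial) := by
    rw [← h1]; field_simp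
  rw [h3, abs_of_pos (by positivity)]
  push_cast
  rw [Real.mul_rpow (by norm_num) k.cast_nonneg, div_le_iff₀ (by positivity)]
  calc _ ≤ c * ((k : ℝ) ^ α * k.factorial) := h2
    _ = _ := by field_simp

theorem exists_choose_odd_le {α : ℝ} (hα : -1 / 2 < α) (hα0 : α < 0) :
    ∃ c > 0, ∀ m k : ℕ, 1 ≤ m → m + 1 = 2 * k →
      |Ring.choose ((k : ℝ) + α - 1) k| ≤ c * ((m : ℝ) ^ α / m) := by
  obtain ⟨c, hc, h⟩ := exists_Gamma_bounds (s := α) (by linarith)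
  have hΓ : 0 < |Real.Gamma α| := by
    have e1 : Real.Gamma (α + 1) = α * Real.Gamma α := Real.Gamma_add_one hα0.ne
    have hg1 : 0 < Real.Gamma (α + 1) := Real.Gamma_pos_of_pos (by linarith)
    rw [abs_pos]
    intro h0
    rw [h0] at e1
    linarith
  refine ⟨4 * c / |Real.Gamma α| / 2 ^ α, by positivity, ?_⟩
  intro m k hm hmk
  have hk : 1 ≤ k := by omega
  have hk' : (1 : ℝ) ≤ k := by exact_mod_cast hk
  have hm' : (1 : ℝ) ≤ m := by exact_mod_cast hm
  have hmk' : (m : ℝ) + 1 = 2 * k := by exact_mod_cast hmk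
  have h1 := congrArg abs (choose_mul_Gamma (β := α) (fun j => by
    rcases Nat.eq_zero_or_pos j with rfl | hj
    · simpa using hα0.ne
    · have : (1 : ℝ) ≤ j := by exact_mod_cast hj
      linarith) k)
  have h2 := (h k hk).1
  have hf : (0 : ℝ) < k.factorial := by positivity
  have hG : 0 < Real.Gamma (k + α) := Real.Gamma_pos_of_pos (by linarith)
  rw [Real.Gamma_add_one (by linarith)] at h2
  rw [abs_mul, abs_mul, abs_of_pos hf, abs_of_pos hG] at h1
  have h3 : |Ring.choose ((k : ℝ) + α - 1) k| =
      Real.Gamma (k + α) / (|Real.Gamma α| * k.factorial) := by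
    rw [← h1]; field_simp
  -- Since `α < 0`, `k ≥ m/2` makes the power smaller.
  have h4 : (k : ℝ) ^ α ≤ (m : ℝ) ^ α / 2 ^ α := by
    rw [← Real.div_rpow (by positivity) (by norm_num)]
    exact Real.rpow_le_rpow_of_nonpos (by positivity) (by linarith) hα0.le
  -- `k = (m+1)/2` and `α > -1/2` give `k + α > m/2`, so `m/4` is a safe lower bound.
  have h5 : (m : ℝ) / 4 * Real.Gamma (k + α) ≤ c * ((m : ℝ) ^ α / 2 ^ α * k.factorial) :=
    calc (m : ℝ) / 4 * Real.Gamma (k + α) ≤ (k + α) * Real.Gamma (k + α) := by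
          gcongr; linarith
      _ ≤ c * ((k : ℝ) ^ α * k.factorial) := h2
      _ ≤ _ := by gcongr
  rw [h3, div_le_iff₀ (by positivity)]
  calc Real.Gamma (k + α) = 4 / m * (m / 4 * Real.Gamma (k + α)) := by field_simp
    _ ≤ 4 / m * (c * ((m : ℝ) ^ α / 2 ^ α * k.factorial)) := by gcongr
    _ = _ := by field_simp

end SGegenbauer

/-! ### Asymptotic constants for the error bounds -/

namespace SGegenbauer

/-- The factor `m + 1` from `C_{m+1}'(0)` cancels against `Γ(m+2) = (m+1) m!`, and `Γ(α+1) = |Γ(α)|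
|α|`. -/
theorem even_prefactor_eq {A L α y G M S c : ℝ} (hα : -1 / 2 < α) (hα0 : α < 0) (m : ℕ)
    (hM : M = (m + 1) * G / S)
    (hG : G = m.factorial * Real.Gamma (2 * α + 1) / Real.Gamma (m + 2 * α + 1) * c) :
    A * (2 : ℝ) ^ (-2 * (m : ℤ) - 1) * Real.Gamma (α + 1) * y * L ^ (m + 1) *
        Real.Gamma (m + 2 * α + 1) /
        (Real.Gamma (2 * α + 1) * Real.Gamma (m + 2) * Real.Gamma (m + α + 1)) * M =
      A * (2 : ℝ) ^ (-2 * (m : ℤ) - 1) * |Real.Gamma α| * |α| * y * L ^ (m + 1) /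
        (S * Real.Gamma (m + α + 1)) * c := by
  have hm : (0 : ℝ) ≤ m := m.cast_nonneg
  have h1 : 0 < Real.Gamma (α + 1) := Real.Gamma_pos_of_pos (by linarith)
  have h2 : 0 < Real.Gamma (2 * α + 1) := Real.Gamma_pos_of_pos (by linarith)
  have h3 : 0 < Real.Gamma (m + 2 * α + 1) := Real.Gamma_pos_of_pos (by linarith)
  have e1 : Real.Gamma (m + 2) = (m + 1) * m.factorial := by
    rw [← Real.Gamma_nat_eq_factorial, ← Real.Gamma_add_one (by positivity)]
    ring_nf
  have e2 : Real.Gamma (α + 1) = |Real.Gamma α| * |α| := by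
    rw [← abs_mul, mul_comm, ← Real.Gamma_add_one hα0.ne, abs_of_pos h1]
  have hf : (0 : ℝ) < m.factorial := by positivity
  rw [hM, hG, e1, mul_assoc (A * _) |Real.Gamma α|, ← e2]
  generalize Real.Gamma (m + 2 * α + 1) = b at *
  generalize Real.Gamma (2 * α + 1) = d at *
  generalize Real.Gamma (α + 1) = e at *
  generalize Real.Gamma (m + α + 1) = g at *
  field_simp

theorem two_zpow_eq (m : ℕ) : (2 : ℝ) ^ (-2 * (m : ℤ) - 1) = 1 / 2 ^ (2 * m + 1) := by
  rw [show -2 * (m : ℤ) - 1 = -((2 * m + 1 : ℕ) : ℤ) by push_cast; ring, zpow_neg, zpow_natCast,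
    one_div]

/-- The condition on `α` sits inside the existential so that choice yields a positive function on
all of `ℝ`. -/
theorem exists_nonneg_constant (α : ℝ) : ∃ c > 0, -1 / 2 < α →
    ∀ (A L y : ℝ) (m : ℕ), 0 < A → 0 < L → 0 ≤ y → 1 ≤ m →
      A * (2 : ℝ) ^ (-2 * (m : ℤ) - 1) * Real.Gamma (α + 1) * y * L ^ (m + 1) *
          Real.Gamma (m + 2 * α + 1) /
          (Real.Gamma (2 * α + 1) * Real.Gamma (m + 2) * Real.Gamma (m + α + 1)) ≤
        A * c * (Real.exp m * L ^ (m + 1) * y /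
          (2 ^ (2 * m + 1) * (m : ℝ) ^ ((m : ℝ) + 3 / 2 - α))) := by
  by_cases hα : -1 / 2 < α
  · obtain ⟨c, hc, h⟩ := exists_Gamma_quotient_le hα
    refine ⟨c, hc, fun _ A L y m hA hL hy hm => ?_⟩
    rw [two_zpow_eq]
    calc _ = A * y * L ^ (m + 1) / 2 ^ (2 * m + 1) *
          (Real.Gamma (α + 1) * Real.Gamma (m + 2 * α + 1) /
            (Real.Gamma (2 * α + 1) * Real.Gamma (m + 2) * Real.Gamma (m + α + 1))) := by ring
      _ ≤ A * y * L ^ (m + 1) / 2 ^ (2 * m + 1) *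
          (c * (Real.exp m / (m : ℝ) ^ ((m : ℝ) + 3 / 2 - α))) := by
        gcongr
        exact h m hm
      _ = _ := by ring
  · exact ⟨1, one_pos, fun h => absurd h hα⟩

/-- `Γ(m+2α+1)` and `(m+1)!` cancel. The binomial contributes `m^(α-1)`, whose `m^α` is absorbed by
`Γ(m+α+1)`, so no `α` is left in the exponent. -/
theorem exists_odd_constant {α : ℝ} (hα : -1 / 2 < α) (hα0 : α < 0) : ∃ c > 0,
    ∀ (A L y : ℝ) (m k : ℕ), 0 < A → 0 < L → 0 ≤ y → 1 ≤ m → m + 1 = 2 * k →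
      A * (2 : ℝ) ^ (-2 * (m : ℤ) - 1) * Real.Gamma (α + 1) * y * L ^ (m + 1) *
          Real.Gamma (m + 2 * α + 1) /
          (Real.Gamma (2 * α + 1) * Real.Gamma (m + 2) * Real.Gamma (m + α + 1)) *
          ((m + 1).factorial * |Real.Gamma (2 * α)| / Real.Gamma (m + 2 * α + 1) *
            |Ring.choose ((k : ℝ) + α - 1) k|) ≤
        A * c * (Real.exp m * L ^ (m + 1) * y /
          (2 ^ (2 * m + 1) * (m : ℝ) ^ ((m : ℝ) + 3 / 2))) := by
  obtain ⟨c, hc, h⟩ := exists_choose_odd_le hα hα0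
  obtain ⟨d, hd, h'⟩ := exists_rpow_div_Gamma_le (α := α) (by linarith)
  have h1 : 0 < Real.Gamma (α + 1) := Real.Gamma_pos_of_pos (by linarith)
  have h2 : 0 < Real.Gamma (2 * α + 1) := Real.Gamma_pos_of_pos (by linarith)
  have hΓ : 0 < |Real.Gamma (2 * α)| := by
    rw [abs_pos]
    intro h0
    rw [Real.Gamma_add_one (by linarith), h0] at h2
    linarith
  refine ⟨Real.Gamma (α + 1) * |Real.Gamma (2 * α)| / Real.Gamma (2 * α + 1) * c * d,
    by positivity, fun A L y m k hA hL hy hm hmk => ?_⟩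
  have hm0 : (0 : ℝ) ≤ m := m.cast_nonneg
  have h3 : 0 < Real.Gamma (m + 2 * α + 1) := Real.Gamma_pos_of_pos (by
    have : (1 : ℝ) ≤ m := by exact_mod_cast hm
    linarith)
  have h4 : 0 < Real.Gamma (m + α + 1) := Real.Gamma_pos_of_pos (by linarith)
  have h5 : Real.Gamma (m + 2) = (m + 1).factorial := by
    rw [← Real.Gamma_nat_eq_factorial]; congr 1; push_cast; ring
  have h7 : (0 : ℝ) < (m + 1).factorial := by positivity
  rw [two_zpow_eq, h5]
  calc _ = A * y * L ^ (m + 1) / 2 ^ (2 * m + 1) *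
        (Real.Gamma (α + 1) * |Real.Gamma (2 * α)| / Real.Gamma (2 * α + 1) *
          (|Ring.choose ((k : ℝ) + α - 1) k| / Real.Gamma (m + α + 1))) := by
        generalize Real.Gamma (m + 2 * α + 1) = b at *
        generalize ((m + 1).factorial : ℝ) = a at *
        field_simp
    _ ≤ A * y * L ^ (m + 1) / 2 ^ (2 * m + 1) *
        (Real.Gamma (α + 1) * |Real.Gamma (2 * α)| / Real.Gamma (2 * α + 1) *
          (c * ((m : ℝ) ^ α / m) / Real.Gamma (m + α + 1))) := by
        gcongr
        exact h m k hm hmk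
    _ = A * y * L ^ (m + 1) / 2 ^ (2 * m + 1) *
        (Real.Gamma (α + 1) * |Real.Gamma (2 * α)| / Real.Gamma (2 * α + 1) * c *
          ((m : ℝ) ^ α / m / Real.Gamma (m + α + 1))) := by ring
    _ ≤ A * y * L ^ (m + 1) / 2 ^ (2 * m + 1) *
        (Real.Gamma (α + 1) * |Real.Gamma (2 * α)| / Real.Gamma (2 * α + 1) * c *
          (d * (Real.exp m / (m : ℝ) ^ ((m : ℝ) + 3 / 2)))) := by
        gcongr
        exact h' m hm
    _ = _ := by ring

theorem exists_even_constant {α : ℝ} (hα : -1 / 2 < α) (hα0 : α < 0) : ∃ c > 0,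
    ∀ (A L y : ℝ) (m k : ℕ), 0 < A → 0 < L → 0 ≤ y → 1 ≤ m → m = 2 * k →
      A * (2 : ℝ) ^ (-2 * (m : ℤ) - 1) * |Real.Gamma α| * |α| * y * L ^ (m + 1) /
          (√((m + 1) * (2 * α + m + 1)) * Real.Gamma (m + α + 1)) *
          |Ring.choose ((k : ℝ) + α) k| ≤
        A * c * (Real.exp m * L ^ (m + 1) * y /
          (2 ^ (2 * m + 1) * (m : ℝ) ^ ((m : ℝ) + 3 / 2))) := by
  obtain ⟨c, hc, h⟩ := exists_choose_even_le hα
  obtain ⟨d, hd, h'⟩ := exists_rpow_div_Gamma_le (α := α) (by linarith)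
  have h1 : 0 < Real.Gamma (α + 1) := Real.Gamma_pos_of_pos (by linarith)
  have e2 : Real.Gamma (α + 1) = |Real.Gamma α| * |α| := by
    rw [← abs_mul, mul_comm, ← Real.Gamma_add_one hα0.ne, abs_of_pos h1]
  refine ⟨Real.Gamma (α + 1) * c * d, by positivity, fun A L y m k hA hL hy hm hmk => ?_⟩
  have hm0 : (1 : ℝ) ≤ m := by exact_mod_cast hm
  have h4 : 0 < Real.Gamma (m + α + 1) := Real.Gamma_pos_of_pos (by linarith)
  -- As `2α + 1 > 0`, the radicand exceeds `(m+1)m`.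
  have hs : (m : ℝ) ≤ √((m + 1) * (2 * α + m + 1)) := Real.le_sqrt_of_sq_le (by nlinarith)
  rw [two_zpow_eq]
  calc _ = A * y * L ^ (m + 1) / 2 ^ (2 * m + 1) * (Real.Gamma (α + 1) *
        (|Ring.choose ((k : ℝ) + α) k| / √((m + 1) * (2 * α + m + 1)) /
          Real.Gamma (m + α + 1))) := by rw [e2]; ring
    _ ≤ A * y * L ^ (m + 1) / 2 ^ (2 * m + 1) * (Real.Gamma (α + 1) *
        (c * (m : ℝ) ^ α / m / Real.Gamma (m + α + 1))) := by
        gcongr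
        exact h m k hm hmk
    _ = A * y * L ^ (m + 1) / 2 ^ (2 * m + 1) * (Real.Gamma (α + 1) * c *
        ((m : ℝ) ^ α / m / Real.Gamma (m + α + 1))) := by ring
    _ ≤ A * y * L ^ (m + 1) / 2 ^ (2 * m + 1) * (Real.Gamma (α + 1) * c *
        (d * (Real.exp m / (m : ℝ) ^ ((m : ℝ) + 3 / 2)))) := by
        gcongr
        exact h' m hm
    _ = _ := by ring

theorem exists_neg_constant (α : ℝ) : ∃ c > 0, -1 / 2 < α → α < 0 →
    ∀ (A L y : ℝ) (m : ℕ), 0 < A → 0 < L → 0 ≤ y → 1 ≤ m →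
      (∀ k : ℕ, m + 1 = 2 * k →
        A * (2 : ℝ) ^ (-2 * (m : ℤ) - 1) * Real.Gamma (α + 1) * y * L ^ (m + 1) *
          Real.Gamma (m + 2 * α + 1) /
          (Real.Gamma (2 * α + 1) * Real.Gamma (m + 2) * Real.Gamma (m + α + 1)) *
          ((m + 1).factorial * |Real.Gamma (2 * α)| / Real.Gamma (m + 2 * α + 1) *
            |Ring.choose ((k : ℝ) + α - 1) k|) ≤
        A * c * (Real.exp m * L ^ (m + 1) * y /
          (2 ^ (2 * m + 1) * (m : ℝ) ^ ((m : ℝ) + 3 / 2)))) ∧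
      (∀ k : ℕ, m = 2 * k →
        A * (2 : ℝ) ^ (-2 * (m : ℤ) - 1) * |Real.Gamma α| * |α| * y * L ^ (m + 1) /
          (√((m + 1) * (2 * α + m + 1)) * Real.Gamma (m + α + 1)) *
          |Ring.choose ((k : ℝ) + α) k| ≤
        A * c * (Real.exp m * L ^ (m + 1) * y /
          (2 ^ (2 * m + 1) * (m : ℝ) ^ ((m : ℝ) + 3 / 2)))) := by
  by_cases hα : -1 / 2 < α ∧ α < 0
  · obtain ⟨c, hc, h⟩ := exists_odd_constant hα.1 hα.2
    obtain ⟨d, hd, h'⟩ := exists_even_constant hα.1 hα.2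
    refine ⟨max c d, lt_max_of_lt_left hc, fun _ _ A L y m hA hL hy hm =>
      ⟨fun k hk => (h A L y m k hA hL hy hm hk).trans ?_,
        fun k hk => (h' A L y m k hA hL hy hm hk).trans ?_⟩⟩
    · gcongr
      exact le_max_left _ _
    · gcongr
      exact le_max_right _ _
  · exact ⟨1, one_pos, fun h1 h2 => absurd ⟨h1, h2⟩ hα⟩

end SGegenbauer

/-! ### Assembly of the error bounds -/

theorem mainTheorem5 :
    ∃ D₁ D₂ : ℝ → ℝ, (∀ α : ℝ, -1 / 2 < α → 0 < D₁ α ∧ 0 < D₂ α) ∧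
      ∀ (L A : ℝ) (m n : ℕ) (f : ℝ → ℝ) (x α : Fin (n + 1) → ℝ),
        0 < L → 0 < A →
        ContDiffOn ℝ ((m + 1 : ℕ) : WithTop ℕ∞) f (Set.Icc 0 L) →
        (∀ t ∈ Set.Icc 0 L, |iteratedDerivWithin (m + 1) f (Set.Icc 0 L) t| ≤ A) →
        (∀ i, x i ∈ Set.Icc 0 L) →
        (∀ i, SGegenbauer.IsOptimal L (x i) m (α i)) →
        ∀ i : Fin (n + 1),
          (0 ≤ α i →
            |SGegenbauer.quadError L (α i) m f (x i)| ≤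
              A * (2 : ℝ) ^ (-2 * (m : ℤ) - 1) * Real.Gamma (α i + 1) * x i * L ^ (m + 1) *
                  Real.Gamma (m + 2 * α i + 1) /
                (Real.Gamma (2 * α i + 1) * Real.Gamma (m + 2) * Real.Gamma (m + α i + 1))) ∧
          (∀ k : ℕ, m + 1 = 2 * k → α i < 0 →
            |SGegenbauer.quadError L (α i) m f (x i)| ≤
              A * (2 : ℝ) ^ (-2 * (m : ℤ) - 1) * Real.Gamma (α i + 1) * x i * L ^ (m + 1) *
                  Real.Gamma (m + 2 * α i + 1) /
                (Real.Gamma (2 * α i + 1) * Real.Gamma (m + 2) * Real.Gamma (m + α i + 1)) *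
              ((m + 1).factorial * |Real.Gamma (2 * α i)| / Real.Gamma (m + 2 * α i + 1) *
                |Ring.choose ((k : ℝ) + α i - 1) k|)) ∧
          (∀ k : ℕ, m = 2 * k → α i < 0 →
            (|SGegenbauer.quadError L (α i) m f (x i)| ≤
              A * (2 : ℝ) ^ (-2 * (m : ℤ) - 1) * |Real.Gamma (α i)| * |α i| * x i * L ^ (m + 1) /
                (Real.sqrt ((m + 1) * (2 * α i + m + 1)) * Real.Gamma (m + α i + 1)) *
                |Ring.choose ((k : ℝ) + α i) k|) ∧
            (0 < x i →
              |SGegenbauer.quadError L (α i) m f (x i)| <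
                A * (2 : ℝ) ^ (-2 * (m : ℤ) - 1) * |Real.Gamma (α i)| * |α i| * x i *
                    L ^ (m + 1) /
                  (Real.sqrt ((m + 1) * (2 * α i + m + 1)) * Real.Gamma (m + α i + 1)) *
                  |Ring.choose ((k : ℝ) + α i) k|)) ∧
          (1 ≤ m → 0 ≤ α i →
            |SGegenbauer.quadError L (α i) m f (x i)| ≤
              (A * D₁ (α i)) *
                (Real.exp m * L ^ (m + 1) * x i /
                  (2 ^ (2 * m + 1) * (m : ℝ) ^ ((m : ℝ) + 3 / 2 - α i)))) ∧
          (1 ≤ m → α i < 0 →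
            |SGegenbauer.quadError L (α i) m f (x i)| ≤
              (A * D₁ (α i) * D₂ (α i)) *
                (Real.exp m * L ^ (m + 1) * x i /
                  (2 ^ (2 * m + 1) * (m : ℝ) ^ ((m : ℝ) + 3 / 2)))) := by
  choose D hD0 hD using SGegenbauer.exists_nonneg_constant
  choose E hE0 hE using SGegenbauer.exists_neg_constant
  -- The quotient makes `D₁ D₂` equal to the constant `E` for negative `α`.
  refine ⟨D, fun a => E a / D a, fun a _ => ⟨hD0 a, div_pos (hE0 a) (hD0 a)⟩, ?_⟩
  intro L A m n f x α hL hA0 hf hA hx hopt i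
  obtain ⟨hα, -⟩ := hopt i
  have hy := hx i
  generalize x i = y at hy ⊢
  generalize α i = a at hα ⊢
  have hbound := fun M => SGegenbauer.abs_quadError_le (M := M) hL hA0.le hα hf hA hy
  simp only [SGegenbauer.interpolation_factor_eq_Gamma hL hα] at hbound
  have h1 : 0 ≤ a → _ := fun ha =>
    (hbound 1 fun t ht => SGegenbauer.abs_eval_gegenbauer_le_one ha _ ht).trans_eq (mul_one _)
  have h2 : ∀ k : ℕ, m + 1 = 2 * k → a < 0 → _ := fun k hk ha =>
    hbound ((m + 1).factorial * |Real.Gamma (2 * a)| / Real.Gamma (m + 2 * a + 1) *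
      |Ring.choose ((k : ℝ) + a - 1) k|) fun t ht => by
      have e := SGegenbauer.abs_eval_zero_gegenbauer_even' hα ha (k := k) (by omega)
      have hk' : (m : ℝ) + 1 = 2 * k := by exact_mod_cast hk
      rw [show (m : ℝ) + 2 * a + 1 = 2 * k + 2 * a by linarith, hk, ← e]
      exact SGegenbauer.abs_eval_gegenbauer_even_le hα ha (by omega) ht
  -- `M'` is the true maximum and `M` the energy bound. The gap gives strictness once the prefactor
  -- is positive, that is for `y > 0`.
  have h3 : ∀ k : ℕ, m = 2 * k → a < 0 → ∃ M' M : ℝ, M' < M ∧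
      (∀ t : ℝ, |t| ≤ 1 → |(SGegenbauer.gegenbauer a (m + 1)).eval t| ≤ M') ∧
      A * (2 : ℝ) ^ (-2 * (m : ℤ) - 1) * Real.Gamma (a + 1) * y * L ^ (m + 1) *
        Real.Gamma (m + 2 * a + 1) /
        (Real.Gamma (2 * a + 1) * Real.Gamma (m + 2) * Real.Gamma (m + a + 1)) * M =
      A * (2 : ℝ) ^ (-2 * (m : ℤ) - 1) * |Real.Gamma a| * |a| * y * L ^ (m + 1) /
        (√((m + 1) * (2 * a + m + 1)) * Real.Gamma (m + a + 1)) *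
        |Ring.choose ((k : ℝ) + a) k| := by
    rintro k rfl ha
    obtain ⟨M', hlt, hM'⟩ := SGegenbauer.exists_abs_eval_gegenbauer_odd_le hα ha k
    refine ⟨M', _, hlt, hM', SGegenbauer.even_prefactor_eq hα ha (2 * k)
      (G := |(SGegenbauer.gegenbauer a (2 * k)).eval 0|) (by push_cast; rfl) ?_⟩
    have e := SGegenbauer.abs_eval_zero_gegenbauer_even hα k
    have h5 : 0 < Real.Gamma (2 * a + 1) := Real.Gamma_pos_of_pos (by linarith)
    have h6 : 0 < Real.Gamma (2 * k + 2 * a + 1) := Real.Gamma_pos_of_pos (by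
      have : (0 : ℝ) ≤ k := k.cast_nonneg
      linarith)
    rw [← abs_abs, e, abs_mul, abs_of_pos (by positivity)]
    push_cast
    rfl
  have h3le : ∀ k : ℕ, m = 2 * k → a < 0 → |SGegenbauer.quadError L a m f y| ≤
      A * (2 : ℝ) ^ (-2 * (m : ℤ) - 1) * |Real.Gamma a| * |a| * y * L ^ (m + 1) /
        (√((m + 1) * (2 * a + m + 1)) * Real.Gamma (m + a + 1)) *
        |Ring.choose ((k : ℝ) + a) k| := fun k hk ha => by
    obtain ⟨M', M, hlt, hM', heq⟩ := h3 k hk ha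
    exact (hbound M fun t ht => (hM' t ht).trans hlt.le).trans_eq heq
  refine ⟨h1, h2, fun k hk ha => ⟨h3le k hk ha, fun hy0 => ?_⟩, fun hm ha => ?_, fun hm ha => ?_⟩
  · obtain ⟨M', M, hlt, hM', heq⟩ := h3 k hk ha
    rw [← heq]
    refine (hbound M' hM').trans_lt (mul_lt_mul_of_pos_left hlt ?_)
    have hm : (0 : ℝ) ≤ m := m.cast_nonneg
    have g1 : 0 < Real.Gamma (a + 1) := Real.Gamma_pos_of_pos (by linarith)
    have g2 : 0 < Real.Gamma (2 * a + 1) := Real.Gamma_pos_of_pos (by linarith)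
    have g3 : 0 < Real.Gamma (m + 2 * a + 1) := Real.Gamma_pos_of_pos (by linarith)
    have g4 : 0 < Real.Gamma (m + a + 1) := Real.Gamma_pos_of_pos (by linarith)
    have g5 : 0 < Real.Gamma ((m : ℝ) + 2) := Real.Gamma_pos_of_pos (by linarith)
    positivity
  · exact (h1 ha).trans (hD a hα A L y m hA0 hL hy.1 hm)
  · have hc : D a * (E a / D a) = E a := by
      have := (hD0 a).ne'
      field_simp
    beta_reduce
    rw [mul_assoc A, hc]
    obtain ⟨hodd, heven⟩ := hE a hα ha A L y m hA0 hL hy.1 hm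
    rcases Nat.even_or_odd' m with ⟨k, hk | hk⟩
    · exact (h3le k hk ha).trans (heven k hk)
    -- For `m = 2k + 1` the half index `(m+1)/2` is `k + 1`.
    · exact (h2 (k + 1) (by omega) ha).trans (hodd (k + 1) (by omega))
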